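/- Let $(\Omega,\mu)$ be a probability space, let $1\le q<\infty$, and let $L_q(\Omega,\mu)$ consist of real- or complex-valued functions with $\|f\|_q:=\left(\int_\Omega|f|^q\,d\mu\right)^{1/q}<\infty$; its elements are specific functions, defined $\mu$-almost everywhere, not equivalence classes. An $N$-dimensional subspace $X_N$ of $L_q(\Omega,\mu)$ means the linear span of $N$ functions from $L_q(\Omega,\mu)$ (so its dimension is at most $N$); there is a $\mu$-null set $E=E(X_N)$ such that all $f\in X_N$ are defined on $\Omega\setminus E$. Write $\|f\|_\infty$ for the (essential) supremum of $|f|$. For $m\in\mathbb N$ and $\varepsilon\in(0,1)$ write $X_N\in\mathcal M(m,q,\varepsilon)$ if there are points $\xi^1,\dots,\xi^m\in\Omega\setminus E$, not necessarily distinct, such that $$(1-\varepsilon)\|f\|_q^q\le\frac1m\sum_{j=1}^m|f(\xi^j)|^q\le(1+\varepsilon)\|f\|_q^q\qquad\text{for all } f\in X_N .$$ Theorem. Let $q\ge 2$, $t>0$ and $\varepsilon\in(0,1)$. There is a number $C=C(t,q,\varepsilon)>0$, depending only on $t$, $q$ and $\varepsilon$, such that the following holds for every probability space $(\Omega,\mu)$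 and every integer $N\ge 2$. If $X_N$ is an $N$-dimensional subspace of $L_q(\Omega,\mu)$ with $$\|f\|_\infty\le t\sqrt N\,\|f\|_2\qquad\text{for all } f\in X_N,$$ then $X_N\in\mathcal M(m,q,\varepsilon)$ for every integer $m\ge C\,N^{q/2}(\log N)^{2-2/q}$. -/

import Mathlib

open MeasureTheory

/-- `X` is an `N`-dimensional subspace of `L_q(Ω, μ)`: a space of genuine functions (not of
equivalence classes) spanned by `N` functions (so its dimension is at most `N`), each of whose
elements is `μ`-a.e. strongly measurable with integrable `q`-th power. -/
def IsLqSubspace {Ω 𝕜 : Type*} [MeasurableSpace Ω] [RCLike 𝕜] (μ : Measure Ω) (q : ℝ) (N : ℕ)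
    (X : Submodule 𝕜 (Ω → 𝕜)) : Prop :=
  (∃ u : Fin N → Ω → 𝕜, X = Submodule.span 𝕜 (Set.range u)) ∧
    ∀ f ∈ X, MemLp f (ENNReal.ofReal q) μ

/-- The Nikol'skii inequality for the pair `(2, ∞)` (Condition E) with constant `t`:
`‖f‖_∞ ≤ t √N ‖f‖_2` for all `f ∈ X`, where `‖f‖_∞` is the essential supremum of `|f|`. -/
def NikolskiiTwoInfty {Ω 𝕜 : Type*} [MeasurableSpace Ω] [RCLike 𝕜] (μ : Measure Ω) (N : ℕ)
    (t : ℝ) (X : Submodule 𝕜 (Ω → 𝕜)) : Prop :=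
  ∀ f ∈ X, eLpNorm f ⊤ μ ≤ ENNReal.ofReal (t * Real.sqrt (N : ℝ)) * eLpNorm f 2 μ

/-- `X ∈ 𝓜(m, q, C₁, C₂)`: there are points `ξ¹, …, ξᵐ` (repetitions allowed) with
`C₁ ‖f‖_q^q ≤ (1/m) ∑ⱼ |f(ξʲ)|^q ≤ C₂ ‖f‖_q^q` for all `f ∈ X`.
The functions in `X` are regarded as defined only outside the exceptional set `E` (a `μ`-null set,
possibly empty), so the points lie outside `E`. -/
def MarcinkiewiczDiscretization {Ω 𝕜 : Type*} [MeasurableSpace Ω] [RCLike 𝕜] (μ : Measure Ω)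
    (E : Set Ω) (X : Submodule 𝕜 (Ω → 𝕜)) (m : ℕ) (q C₁ C₂ : ℝ) : Prop :=
  ∃ ξ : Fin m → Ω, (∀ j, ξ j ∉ E) ∧ ∀ f ∈ X,
    C₁ * ∫ x, ‖f x‖ ^ q ∂μ ≤ (1 / (m : ℝ)) * ∑ j, ‖f (ξ j)‖ ^ q ∧
    (1 / (m : ℝ)) * ∑ j, ‖f (ξ j)‖ ^ q ≤ C₂ * ∫ x, ‖f x‖ ^ q ∂μ

/-- `X ∈ 𝓜(m, q, ε)`, that is, `X ∈ 𝓜(m, q, 1 - ε, 1 + ε)`. -/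
def MarcinkiewiczDiscretizationEps {Ω 𝕜 : Type*} [MeasurableSpace Ω] [RCLike 𝕜] (μ : Measure Ω)
    (E : Set Ω) (X : Submodule 𝕜 (Ω → 𝕜)) (m : ℕ) (q ε : ℝ) : Prop :=
  MarcinkiewiczDiscretization μ E X m q (1 - ε) (1 + ε)

/-! Up to functions vanishing almost everywhere, `X` with the `L²` norm is a Euclidean space of
dimension `d ≤ N` (`exists_isometric_parametrization`), and the Nikol'skii inequality says that
evaluation at almost every point is a functional of norm at most `M = t√N` (`ae_forall_norm_le`).
The strong law of large numbers and compactness of the unit ball provide arbitrarily large samples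
that discretize as accurately as desired (`exists_asymptotic_discretization`). Such a sample of `2 ^
k * m` points is thinned to `m` points by `k` halvings: the points are paired and signs decide which
point of each pair survives (`exists_thinning`). One halving adds the supremum of a Rademacher sum
over the unit ball. Relative to the number `n` of points this error decays geometrically as `n`
doubles, so the last steps, with about `m` points, dominate.

For `q > 2` a halving is controlled by `exists_halving_of_entropy`. The `q`-th power is cut into
dyadic levels `s`, and each level gets a single net in the maximum over all evaluations. The dual
Sudakov inequality (`exists_net`) bounds the logarithm of the size of a net of mesh `s` by a
multiple of `M² log n / s²`. On level `s` the summands are at most `s ^ q`, so sub-Gaussian tails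
and a union bound give errors forming a geometric series, convergent because `q > 2`; no chaining is
needed. The relative error `x` satisfies `x⁴ ≈ M ^ q log n / n`, hence about `N ^ (q / 2) log N`
points suffice.

For `q = 2` the series degenerates. There the Rademacher sum is the quadratic form of a random
Hermitian matrix, and the noncommutative Khintchine inequality bounds it by `√(M² n log N)` up to a
constant (`exists_halving_sq`).

If `m` exceeds a fixed power of `N`, then `log m` is no longer comparable to `log N`; in that range
nets whose size depends only on the dimension are good enough (`exists_net_of_dimension`). The
estimates use one power of `log N`, and the exponent `2 - 2 / q` is at least one. -/

/-! ### Gaussian measure and the dual Sudakov inequality. -/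

section GaussianEntropy

variable {E : Type*} [NormedAddCommGroup E] [InnerProductSpace ℝ E] [FiniteDimensional ℝ E]
  [MeasurableSpace E] [BorelSpace E]

lemma integrable_exp_neg_half_sq_norm :
    Integrable (fun y : E => Real.exp (-‖y‖ ^ 2 / 2)) := by
  have h := GaussianFourier.integrable_cexp_neg_mul_sq_norm_add (V := E) (b := 1 / 2)
    (by norm_num) 0 0
  refine h.norm.congr (Filter.Eventually.of_forall fun y => ?_)
  simp only [Complex.norm_exp]
  congr 1
  have : (-(1 / 2) * (‖y‖ : ℂ) ^ 2 + 0 * ((inner ℝ (0 : E) y : ℝ) : ℂ)) =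
      ((-‖y‖ ^ 2 / 2 : ℝ) : ℂ) := by
    push_cast; ring
  rw [this, Complex.ofReal_re]

lemma integral_exp_neg_half_sq_norm_pos :
    0 < ∫ y : E, Real.exp (-‖y‖ ^ 2 / 2) :=
  integral_exp_pos integrable_exp_neg_half_sq_norm

/-- A translate of a symmetric set loses at most the factor `exp (-‖x‖² / 2)` of Gaussian mass. -/
lemma gaussian_translate_ge {U : Set E} (hU : MeasurableSet U) (hsymm : ∀ y ∈ U, -y ∈ U) (x : E) :
    Real.exp (-‖x‖ ^ 2 / 2) * ∫ y in U, Real.exp (-‖y‖ ^ 2 / 2) ≤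
      ∫ y in U, Real.exp (-‖y + x‖ ^ 2 / 2) := by
  have hi : ∀ z : E, Integrable (fun y : E => Real.exp (-‖y + z‖ ^ 2 / 2)) := fun z =>
    (integrable_exp_neg_half_sq_norm (E := E)).comp_add_right z
  -- By symmetry of `U` the translates by `x` and `-x` have equal mass; averaging them replaces `exp
  -- (-⟪y, x⟫)` by a hyperbolic cosine, which is at least one.
  have hrefl : ∫ y in U, Real.exp (-‖y + x‖ ^ 2 / 2) =
      ∫ y in U, Real.exp (-‖y + -x‖ ^ 2 / 2) := by
    rw [← integral_indicator hU, ← integral_indicator hU, ← integral_neg_eq_self]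
    congr 1
    ext y
    have hy : -y ∈ U ↔ y ∈ U := ⟨fun h => by simpa using hsymm _ h, hsymm y⟩
    by_cases h : y ∈ U
    · rw [Set.indicator_of_mem h, Set.indicator_of_mem (hy.2 h), ← norm_neg]
      rw [show -(-y + x) = y + -x by abel]
    · rw [Set.indicator_of_notMem h, Set.indicator_of_notMem (fun h' => h (hy.1 h'))]
  have hsum : 2 * (Real.exp (-‖x‖ ^ 2 / 2) * ∫ y in U, Real.exp (-‖y‖ ^ 2 / 2)) ≤
      (∫ y in U, Real.exp (-‖y + x‖ ^ 2 / 2)) + ∫ y in U, Real.exp (-‖y + -x‖ ^ 2 / 2) := by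
    rw [← integral_add (hi x).integrableOn (hi (-x)).integrableOn, ← integral_const_mul,
      ← integral_const_mul]
    refine integral_mono ?_ ?_ fun y => ?_
    · exact ((integrable_exp_neg_half_sq_norm.integrableOn).const_mul _).const_mul _
    · exact (hi x).integrableOn.add (hi (-x)).integrableOn
    · have e1 : Real.exp (-‖y + x‖ ^ 2 / 2) =
          Real.exp (-‖x‖ ^ 2 / 2) * Real.exp (-‖y‖ ^ 2 / 2) * Real.exp (-inner ℝ y x) := by
        rw [← Real.exp_add, ← Real.exp_add, norm_add_sq_real]; congr 1; ring
      have e2 : Real.exp (-‖y + -x‖ ^ 2 / 2) =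
          Real.exp (-‖x‖ ^ 2 / 2) * Real.exp (-‖y‖ ^ 2 / 2) * Real.exp (inner ℝ y x) := by
        rw [← Real.exp_add, ← Real.exp_add, norm_add_sq_real, inner_neg_right, norm_neg]
        congr 1; ring
      have h2 : 2 ≤ Real.exp (-inner ℝ y x) + Real.exp (inner ℝ y x) := by
        have := Real.add_one_le_exp (-inner ℝ y x)
        have := Real.add_one_le_exp (inner ℝ y x)
        linarith
      simp only [e1, e2]
      have := mul_le_mul_of_nonneg_left h2
        (by positivity : 0 ≤ Real.exp (-‖x‖ ^ 2 / 2) * Real.exp (-‖y‖ ^ 2 / 2))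
      linarith
  rw [← hrefl] at hsum
  linarith

/-- Packing bound for disjoint translates of a symmetric set of Gaussian measure at least `1/2`. -/
lemma card_le_of_disjoint_translates {U : Set E} (hU : MeasurableSet U)
    (hsymm : ∀ y ∈ U, -y ∈ U)
    (hmass : (∫ y : E, Real.exp (-‖y‖ ^ 2 / 2)) ≤ 2 * ∫ y in U, Real.exp (-‖y‖ ^ 2 / 2))
    {T : Finset E} {r : ℝ} (hT : ∀ c ∈ T, ‖c‖ ≤ r)
    (hdisj : ∀ c ∈ T, ∀ c' ∈ T, ∀ y, y - c ∈ U → y - c' ∈ U → c = c') :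
    (T.card : ℝ) ≤ 2 * Real.exp (r ^ 2 / 2) := by
  set Z := ∫ y : E, Real.exp (-‖y‖ ^ 2 / 2) with hZ
  have hZpos : 0 < Z := integral_exp_neg_half_sq_norm_pos
  have hint : ∀ c : E, Integrable (fun y : E =>
      ({z | z - c ∈ U} : Set E).indicator (fun y => Real.exp (-‖y‖ ^ 2 / 2)) y) := fun c =>
    integrable_exp_neg_half_sq_norm.indicator (measurable_id.sub_const c hU)
  have hlow : ∀ c ∈ T, Real.exp (-r ^ 2 / 2) * (Z / 2) ≤
      ∫ y : E, ({z | z - c ∈ U} : Set E).indicator (fun y => Real.exp (-‖y‖ ^ 2 / 2)) y := by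
    intro c hc
    have h1 := gaussian_translate_ge hU hsymm c
    have h2 : ∫ y in U, Real.exp (-‖y + c‖ ^ 2 / 2) =
        ∫ y : E, ({z | z - c ∈ U} : Set E).indicator (fun y => Real.exp (-‖y‖ ^ 2 / 2)) y := by
      rw [← integral_indicator hU, ← integral_sub_right_eq_self _ c]
      congr 1
      ext y
      simp [Set.indicator, sub_add_cancel]
    rw [← h2]
    refine le_trans ?_ h1
    have h3 : Real.exp (-r ^ 2 / 2) ≤ Real.exp (-‖c‖ ^ 2 / 2) := by
      apply Real.exp_le_exp.2
      have := pow_le_pow_left₀ (norm_nonneg c) (hT c hc) 2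
      linarith
    exact mul_le_mul h3 (by linarith) (by positivity) (by positivity)
  have hup : ∑ c ∈ T, ∫ y : E,
      ({z | z - c ∈ U} : Set E).indicator (fun y => Real.exp (-‖y‖ ^ 2 / 2)) y ≤ Z := by
    rw [← integral_finsetSum _ fun c _ => hint c]
    refine integral_mono (integrable_finsetSum _ fun c _ => hint c)
      integrable_exp_neg_half_sq_norm fun y => ?_
    by_cases hy : ∃ c ∈ T, y - c ∈ U
    · obtain ⟨c, hc, hyc⟩ := hy
      simp only
      rw [Finset.sum_eq_single_of_mem c hc]
      · exact Set.indicator_le_self' (fun _ _ => by positivity) _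
      · intro c' hc' hne
        exact Set.indicator_of_notMem (s := {z | z - c' ∈ U})
          (fun h => hne (hdisj c' hc' c hc y h hyc)) _
    · push Not at hy
      simp only
      rw [Finset.sum_eq_zero]
      · positivity
      · intro c hc
        exact Set.indicator_of_notMem (s := {z | z - c ∈ U}) (hy c hc) _
  have h4 : (T.card : ℝ) * (Real.exp (-r ^ 2 / 2) * (Z / 2)) ≤ Z := by
    refine le_trans ?_ hup
    rw [← nsmul_eq_mul]
    exact Finset.card_nsmul_le_sum _ _ _ hlow
  have h5 : Real.exp (-r ^ 2 / 2) * Real.exp (r ^ 2 / 2) = 1 := by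
    rw [← Real.exp_add]; simp; ring
  have h6 : (T.card : ℝ) * Real.exp (-r ^ 2 / 2) ≤ 2 := by
    by_contra h
    push Not at h
    nlinarith
  calc (T.card : ℝ) = T.card * Real.exp (-r ^ 2 / 2) * Real.exp (r ^ 2 / 2) := by
        rw [mul_assoc, h5, mul_one]
    _ ≤ _ := by gcongr

/-- Gaussian tail of a linear functional. -/
lemma gaussian_halfspace_le (w : E) {M a : ℝ} (hM : 0 < M) (ha : 0 ≤ a) (hw : ‖w‖ ≤ M) :
    ∫ y in {y : E | a ≤ inner ℝ w y}, Real.exp (-‖y‖ ^ 2 / 2) ≤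
      Real.exp (-a ^ 2 / (2 * M ^ 2)) * ∫ y : E, Real.exp (-‖y‖ ^ 2 / 2) := by
  -- Exponential Chebyshev in the form of a shift: on the half-space the density is dominated
  -- pointwise by a multiple of the density translated by `l • w`, and this `l` optimizes the
  -- factor.
  set l := a / M ^ 2 with hl
  have hl0 : 0 ≤ l := by positivity
  have hmeas : MeasurableSet {y : E | a ≤ inner ℝ w y} :=
    measurableSet_le measurable_const (by fun_prop)
  rw [← integral_indicator hmeas, ← integral_sub_right_eq_self (fun y : E => Real.exp (-‖y‖ ^ 2 / 2)) (l • w),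
    ← integral_const_mul]
  refine integral_mono (integrable_exp_neg_half_sq_norm.indicator hmeas)
    ((integrable_exp_neg_half_sq_norm.comp_sub_right (l • w)).const_mul _) fun y => ?_
  simp only [Set.indicator]
  split_ifs with h
  · rw [← Real.exp_add]
    apply Real.exp_le_exp.2
    have h' : a ≤ inner ℝ w y := h
    rw [norm_sub_sq_real, inner_smul_right, norm_smul, real_inner_comm, Real.norm_of_nonneg hl0,
      mul_pow]
    have h1 : l * a ≤ l * inner ℝ w y := mul_le_mul_of_nonneg_left h' hl0
    have h2 : l ^ 2 * ‖w‖ ^ 2 ≤ l ^ 2 * M ^ 2 := by gcongr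
    have h3 : l ^ 2 * M ^ 2 = a ^ 2 / M ^ 2 := by rw [hl]; field_simp
    have h4 : l * a = a ^ 2 / M ^ 2 := by rw [hl]; ring
    have h5 : -a ^ 2 / (2 * M ^ 2) = -(a ^ 2 / M ^ 2) / 2 := by field_simp
    rw [h5]
    linarith
  · positivity

/-- Dual Sudakov bound for the packing numbers of the Euclidean ball with respect to the maximum of
finitely many linear functionals. -/
lemma card_separated_le {J : Type*} [Fintype J] [Nonempty J] (l : J → E →ₗ[ℝ] ℝ) {M s : ℝ}
    (hM : 0 < M) (hl : ∀ j y, |l j y| ≤ M * ‖y‖) (hs : 0 < s) (hsM : s ≤ M)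
    {T : Finset E} (hT : ∀ c ∈ T, ‖c‖ ≤ 1)
    (hsep : ∀ c ∈ T, ∀ c' ∈ T, (∀ j, |l j (c - c')| ≤ s) → c = c') :
    (T.card : ℝ) ≤ Real.exp (6 * M ^ 2 * Real.log (4 * Fintype.card J) / s ^ 2) := by
  classical
  set n : ℝ := (Fintype.card J : ℝ) with hn
  have hn1 : 1 ≤ n := by
    rw [hn]; exact_mod_cast Fintype.card_pos
  set L := Real.log (4 * n) with hL
  have hL1 : 1 ≤ L := by
    rw [hL, Real.le_log_iff_exp_le (by positivity)]
    have := Real.exp_one_lt_d9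
    linarith
  -- With this `a` each half-space has relative mass at most `1 / (4n)`. The slab complement is
  -- covered by `2n` of them, so `U` keeps half of the Gaussian mass.
  set a := Real.sqrt (2 * M ^ 2 * L) with ha
  have ha2 : a ^ 2 = 2 * M ^ 2 * L := Real.sq_sqrt (by positivity)
  have hapos : 0 < a := Real.sqrt_pos.2 (by positivity)
  have hw : ∀ j, ∃ w : E, ‖w‖ ≤ M ∧ ∀ y, l j y = inner ℝ w y := by
    intro j
    refine ⟨(InnerProductSpace.toDual ℝ E).symm (LinearMap.toContinuousLinearMap (l j)), ?_, ?_⟩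
    · rw [LinearIsometryEquiv.norm_map]
      exact ContinuousLinearMap.opNorm_le_bound _ hM.le fun y => by simpa using hl j y
    · intro y; simp
  choose w hwM hw using hw
  set U : Set E := {y | ∀ j, |l j y| < a} with hUdef
  have hcont : ∀ j, Continuous fun y => l j y := fun j => (l j).continuous_of_finiteDimensional
  have hU : MeasurableSet U := by
    rw [hUdef, Set.ofPred_forall]
    exact MeasurableSet.iInter fun j =>
      measurableSet_lt ((hcont j).abs.measurable) measurable_const
  have hUsymm : ∀ y ∈ U, -y ∈ U := fun y hy j => by
    rw [map_neg, abs_neg]; exact hy j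
  set Z := ∫ y : E, Real.exp (-‖y‖ ^ 2 / 2) with hZ
  have hZpos : 0 < Z := integral_exp_neg_half_sq_norm_pos
  have hint := integrable_exp_neg_half_sq_norm (E := E)
  have hexp : Real.exp (-a ^ 2 / (2 * M ^ 2)) = 1 / (4 * n) := by
    have : -a ^ 2 / (2 * M ^ 2) = -L := by
      rw [ha2]; field_simp
    rw [this, Real.exp_neg, hL, Real.exp_log (by positivity), one_div]
  have hcompl : ∫ y in Uᶜ, Real.exp (-‖y‖ ^ 2 / 2) ≤ Z / 2 := by
    have hms : ∀ v : E, MeasurableSet {y : E | a ≤ inner ℝ v y} := fun v =>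
      measurableSet_le measurable_const (by fun_prop)
    have h1 : ∫ y in Uᶜ, Real.exp (-‖y‖ ^ 2 / 2) ≤
        ∑ j, ((∫ y in {y : E | a ≤ inner ℝ (w j) y}, Real.exp (-‖y‖ ^ 2 / 2)) +
          ∫ y in {y : E | a ≤ inner ℝ (-w j) y}, Real.exp (-‖y‖ ^ 2 / 2)) := by
      simp only [← integral_indicator hU.compl, ← integral_indicator (hms _)]
      simp only [← integral_add (hint.indicator (hms (w _))) (hint.indicator (hms (-w _)))]
      have hadd := fun j => (hint.indicator (hms (w j))).add (hint.indicator (hms (-w j)))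
      simp only [Pi.add_def] at hadd
      rw [← integral_finsetSum _ fun j _ => hadd j]
      refine integral_mono (hint.indicator hU.compl) (integrable_finsetSum _ fun j _ => hadd j) fun y => ?_
      have hnn : ∀ v : E, 0 ≤ Set.indicator {y : E | a ≤ inner ℝ v y}
          (fun y => Real.exp (-‖y‖ ^ 2 / 2)) y := fun v =>
        Set.indicator_nonneg (fun _ _ => by positivity) _
      by_cases hy : y ∈ U
      · rw [Set.indicator_of_notMem (by simpa using hy)]
        exact Finset.sum_nonneg fun j _ => add_nonneg (hnn _) (hnn _)
      · rw [Set.indicator_of_mem (by simpa using hy)]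
        have : ∃ j, a ≤ |l j y| := by
          by_contra hcon
          push Not at hcon
          exact hy hcon
        obtain ⟨j, hj⟩ := this
        refine le_trans ?_ (Finset.single_le_sum
          (fun j _ => add_nonneg (hnn (w j)) (hnn (-w j))) (Finset.mem_univ j))
        rcases le_abs'.1 hj with h | h
        · have : y ∈ {y : E | a ≤ inner ℝ (-w j) y} := by
            simp only [Set.mem_ofPred_eq, inner_neg_left, ← hw]; linarith
          rw [Set.indicator_of_mem this]
          linarith [hnn (w j)]
        · have : y ∈ {y : E | a ≤ inner ℝ (w j) y} := by
            simp only [Set.mem_ofPred_eq, ← hw]; linarith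
          rw [Set.indicator_of_mem this]
          linarith [hnn (-w j)]
    refine h1.trans ?_
    have h2 : ∀ j, ((∫ y in {y : E | a ≤ inner ℝ (w j) y}, Real.exp (-‖y‖ ^ 2 / 2)) +
          ∫ y in {y : E | a ≤ inner ℝ (-w j) y}, Real.exp (-‖y‖ ^ 2 / 2)) ≤ 1 / (2 * n) * Z := by
      intro j
      have e1 := gaussian_halfspace_le (w j) hM hapos.le (hwM j)
      have e2 := gaussian_halfspace_le (-w j) hM hapos.le (by rw [norm_neg]; exact hwM j)
      rw [hexp] at e1 e2
      have : 1 / (2 * n) * Z = 1 / (4 * n) * Z + 1 / (4 * n) * Z := by field_simp; norm_num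
      rw [this]
      exact add_le_add e1 e2
    refine (Finset.sum_le_sum fun j _ => h2 j).trans ?_
    rw [Finset.sum_const, Finset.card_univ, nsmul_eq_mul, ← hn]
    apply le_of_eq
    field_simp
  have hmass : Z ≤ 2 * ∫ y in U, Real.exp (-‖y‖ ^ 2 / 2) := by
    have := integral_add_compl hU hint
    linarith
  -- Dilation by `r` turns separation `s` into separation `2a`, which makes the translates of `U`
  -- disjoint, while the centres stay in the ball of radius `r`.
  set r := 2 * a / s with hr
  have hrpos : 0 < r := by positivity
  have hinj : Function.Injective (fun c : E => r • c) := smul_right_injective E hrpos.ne'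
  have hcard := card_le_of_disjoint_translates hU hUsymm hmass (T := T.image fun c => r • c)
    (r := r) (by
      intro c hc
      obtain ⟨c', hc', rfl⟩ := Finset.mem_image.1 hc
      rw [norm_smul, Real.norm_of_nonneg hrpos.le]
      nlinarith [hT c' hc'])
    (by
      intro c hc c' hc' y hy hy'
      obtain ⟨c, hcT, rfl⟩ := Finset.mem_image.1 hc
      obtain ⟨c', hcT', rfl⟩ := Finset.mem_image.1 hc'
      refine congrArg (r • ·) (hsep c hcT c' hcT' fun j => ?_)
      have h1 := hy j
      have h2 := hy' j
      have h3 : r * |l j (c - c')| < 2 * a := by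
        rw [← abs_of_pos hrpos, ← abs_mul, ← smul_eq_mul, ← map_smul]
        have : r • (c - c') = (y - r • c') - (y - r • c) := by rw [smul_sub]; abel
        rw [this, map_sub]
        have := abs_sub (l j (y - r • c')) (l j (y - r • c))
        linarith
      have h4 : r * s = 2 * a := by rw [hr]; field_simp
      rw [← h4] at h3
      exact (lt_of_mul_lt_mul_left h3 hrpos.le).le)
  rw [Finset.card_image_of_injective _ hinj] at hcard
  refine hcard.trans ?_
  have h2e : (2 : ℝ) ≤ Real.exp 1 := by
    have := Real.add_one_le_exp (1 : ℝ); linarith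
  calc 2 * Real.exp (r ^ 2 / 2) ≤ Real.exp 1 * Real.exp (r ^ 2 / 2) := by gcongr
    _ = Real.exp (1 + r ^ 2 / 2) := by rw [Real.exp_add]
    _ ≤ _ := by
      apply Real.exp_le_exp.2
      have h1 : r ^ 2 / 2 = 4 * M ^ 2 * L / s ^ 2 := by
        rw [hr, div_pow, mul_pow, ha2]; ring
      rw [h1, le_div_iff₀ (by positivity), add_mul, div_mul_cancel₀ _ (by positivity), one_mul]
      have h2 : s ^ 2 ≤ M ^ 2 := by gcongr
      have h3 : M ^ 2 * 1 ≤ M ^ 2 * L := by gcongr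
      nlinarith

/-- Dual Sudakov bound for covering numbers. -/
lemma exists_net_real {J : Type*} [Fintype J] [Nonempty J] (l : J → E →ₗ[ℝ] ℝ) {M s : ℝ}
    (hM : 0 < M) (hl : ∀ j y, |l j y| ≤ M * ‖y‖) (hs : 0 < s) (hsM : s ≤ M)
    {K : Set E} (hK : ∀ c ∈ K, ‖c‖ ≤ 1) :
    ∃ T : Finset E, ↑T ⊆ K ∧
      (T.card : ℝ) ≤ Real.exp (6 * M ^ 2 * Real.log (4 * Fintype.card J) / s ^ 2) ∧
      ∀ c ∈ K, ∃ g ∈ T, ∀ j, |l j (c - g)| ≤ s := by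
  classical
  by_contra hcon
  push Not at hcon
  -- If no separated set were a net, one could be enlarged forever, against the packing bound.
  have hstep : ∀ k : ℕ, ∃ T : Finset E, ↑T ⊆ K ∧ T.card = k ∧
      ∀ c ∈ T, ∀ c' ∈ T, (∀ j, |l j (c - c')| ≤ s) → c = c' := by
    intro k
    induction k with
    | zero => exact ⟨∅, by simp, rfl, by simp⟩
    | succ k ih =>
      obtain ⟨T, hTK, hcard, hsep⟩ := ih
      obtain ⟨c, hcK, hc⟩ := hcon T hTK
        (card_separated_le l hM hl hs hsM (fun c hc => hK c (hTK hc)) hsep)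
      have hcT : c ∉ T := fun h => by
        obtain ⟨j, hj⟩ := hc c h
        simp at hj
        linarith
      refine ⟨insert c T, ?_, by rw [Finset.card_insert_of_notMem hcT, hcard], ?_⟩
      · rw [Finset.coe_insert]
        exact Set.insert_subset hcK hTK
      · intro a ha b hb hab
        rcases Finset.mem_insert.1 ha with ha' | ha' <;> rcases Finset.mem_insert.1 hb with hb' | hb'
        · rw [ha', hb']
        · obtain ⟨j, hj⟩ := hc b hb'
          exact absurd (ha' ▸ hab j) (not_le.2 hj)
        · obtain ⟨j, hj⟩ := hc a ha'
          refine absurd (hb' ▸ hab j) (not_le.2 ?_)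
          rwa [← abs_neg, ← map_neg, neg_sub]
        · exact hsep a ha' b hb' hab
  obtain ⟨k, hk⟩ := exists_nat_gt (Real.exp (6 * M ^ 2 * Real.log (4 * Fintype.card J) / s ^ 2))
  obtain ⟨T, hTK, hcard, hsep⟩ := hstep k
  have := card_separated_le l hM hl hs hsM (fun c hc => hK c (hTK hc)) hsep
  rw [hcard] at this
  linarith

end GaussianEntropy

/-- Dual Sudakov bound for `𝕜`-valued functionals. -/
lemma exists_net {𝕜 V : Type*} [RCLike 𝕜] [NormedAddCommGroup V] [InnerProductSpace 𝕜 V]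
    [FiniteDimensional 𝕜 V] {J : Type*} [Fintype J] [Nonempty J]
    (ev : J → V →ₗ[𝕜] 𝕜) {M s : ℝ}
    (hM : 0 < M) (hev : ∀ j y, ‖ev j y‖ ≤ M * ‖y‖) (hs : 0 < s) (hsM : s ≤ M)
    {K : Set V} (hK : ∀ c ∈ K, ‖c‖ ≤ 1) :
    ∃ T : Finset V, ↑T ⊆ K ∧
      (T.card : ℝ) ≤ Real.exp (24 * M ^ 2 * Real.log (8 * Fintype.card J) / s ^ 2) ∧
      ∀ c ∈ K, ∃ g ∈ T, ∀ j, ‖ev j (c - g)‖ ≤ s := by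
  let _ : InnerProductSpace ℝ V := InnerProductSpace.rclikeToReal 𝕜 V
  have _ : IsScalarTower ℝ 𝕜 V :=
    ⟨fun r a v => by rw [Algebra.smul_def, mul_smul]; rfl⟩
  have _ : FiniteDimensional ℝ V := FiniteDimensional.trans ℝ 𝕜 V
  let _ : MeasurableSpace V := borel V
  have _ : BorelSpace V := ⟨rfl⟩
  -- Real and imaginary parts are approximated to within `s / 2` each. This doubles the number of
  -- functionals and multiplies the constant 6 by 4.
  let l : J × Bool → V →ₗ[ℝ] ℝ := fun p =>
    (if p.2 then RCLike.reLm else RCLike.imLm).comp ((ev p.1).restrictScalars ℝ)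
  have hl : ∀ p y, |l p y| ≤ M * ‖y‖ := by
    rintro ⟨j, b⟩ y
    refine le_trans ?_ (hev j y)
    cases b
    · exact RCLike.abs_im_le_norm _
    · exact RCLike.abs_re_le_norm _
  obtain ⟨T, hTK, hcard, hnet⟩ := exists_net_real l hM hl (half_pos hs) (by linarith) hK
  refine ⟨T, hTK, hcard.trans (le_of_eq ?_), fun c hc => ?_⟩
  · rw [Fintype.card_prod, Fintype.card_bool]
    push_cast
    congr 1
    rw [show (4 * ((Fintype.card J : ℝ) * 2)) = 8 * Fintype.card J by ring]
    field_simp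
    ring
  · obtain ⟨g, hg, h⟩ := hnet c hc
    refine ⟨g, hg, fun j => ?_⟩
    have h1 : |RCLike.re (ev j (c - g))| ≤ s / 2 := h (j, true)
    have h2 : |RCLike.im (ev j (c - g))| ≤ s / 2 := h (j, false)
    have h3 : ‖ev j (c - g)‖ ≤ |RCLike.re (ev j (c - g))| + |RCLike.im (ev j (c - g))| := by
      conv_lhs => rw [← RCLike.re_add_im (ev j (c - g))]
      refine (norm_add_le _ _).trans ?_
      rw [norm_mul, RCLike.norm_ofReal, RCLike.norm_ofReal]
      have := mul_le_mul_of_nonneg_left (by rw [RCLike.norm_I]; split_ifs <;> norm_num : ‖(RCLike.I : 𝕜)‖ ≤ 1)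
        (abs_nonneg (RCLike.im (ev j (c - g))))
      linarith
    linarith

/-! ### Sub-Gaussian bounds for Rademacher sums. -/

/-- The sign attached to a Boolean. -/
def boolSign (b : Bool) : ℝ := if b then 1 else -1

@[simp] lemma boolSign_true : boolSign true = 1 := rfl
@[simp] lemma boolSign_false : boolSign false = -1 := rfl

/-- Independence of the signs factors the exponential moment into hyperbolic cosines, and `cosh x ≤
exp (x² / 2)`. -/
lemma sum_exp_signed_sum_le {ι : Type*} [Fintype ι] [DecidableEq ι] (a : ι → ℝ) :
    ∑ σ : ι → Bool, Real.exp (∑ j, boolSign (σ j) * a j) ≤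
      2 ^ Fintype.card ι * Real.exp ((∑ j, a j ^ 2) / 2) := by
  have h1 : ∑ σ : ι → Bool, Real.exp (∑ j, boolSign (σ j) * a j) =
      ∏ j, (2 * Real.cosh (a j)) := by
    simp only [Real.exp_sum]
    rw [← Fintype.piFinset_univ, ← Finset.prod_univ_sum (fun _ => Finset.univ)
      (fun j b => Real.exp (boolSign b * a j))]
    refine Finset.prod_congr rfl fun j _ => ?_
    rw [Fintype.sum_bool, Real.cosh_eq]
    simp
    ring
  rw [h1, Finset.prod_mul_distrib, Finset.prod_const, Finset.card_univ]
  gcongr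
  rw [Finset.sum_div, Real.exp_sum]
  exact Finset.prod_le_prod (fun j _ => (Real.cosh_pos _).le) fun j _ =>
    Real.cosh_le_exp_half_sq _

/-- Simultaneous sub-Gaussian bounds for finitely many signed sums. -/
lemma exists_signs {ι τ : Type*} [Fintype ι] (T : Finset τ) (a : τ → ι → ℝ)
    (B : τ → ℝ) (hB : ∀ t ∈ T, 0 < B t) (hsum : ∑ t ∈ T, 2 * Real.exp (-B t) < 1) :
    ∃ σ : ι → Bool, ∀ t ∈ T,
      |∑ j, boolSign (σ j) * a t j| ≤ Real.sqrt (2 * B t * ∑ j, a t j ^ 2) := by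
  classical
  set V : τ → ℝ := fun t => ∑ j, a t j ^ 2 with hV
  have hV0 : ∀ t, 0 ≤ V t := fun t => Finset.sum_nonneg fun j _ => sq_nonneg _
  -- The Chernoff parameter optimal for deviation `√(2 B V)`. The weights `W` scale the two-sided
  -- exponential moments so that their total average is below one; a choice of signs below that
  -- average serves all `t` at once.
  set lam : τ → ℝ := fun t => Real.sqrt (2 * B t / V t) with hlam
  set F : (ι → Bool) → τ → ℝ := fun σ t =>
    Real.exp (∑ j, boolSign (σ j) * (lam t * a t j)) +
      Real.exp (∑ j, boolSign (σ j) * (-lam t * a t j)) with hF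
  set W : τ → ℝ := fun t => Real.exp (-(lam t ^ 2 * V t / 2) - B t) with hW
  have havg : ∑ σ : ι → Bool, ∑ t ∈ T, W t * F σ t < ∑ σ : ι → Bool, (1 : ℝ) := by
    rw [Finset.sum_comm]
    have h1 : ∀ t ∈ T, ∑ σ : ι → Bool, W t * F σ t ≤
        2 ^ Fintype.card ι * (2 * Real.exp (-B t)) := by
      intro t _
      rw [← Finset.mul_sum]
      have e1 := sum_exp_signed_sum_le (fun j => lam t * a t j)
      have e2 := sum_exp_signed_sum_le (fun j => -lam t * a t j)
      have e3 : ∑ j, (lam t * a t j) ^ 2 = lam t ^ 2 * V t := by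
        rw [hV, Finset.mul_sum]; exact Finset.sum_congr rfl fun j _ => by ring
      have e4 : ∑ j, (-lam t * a t j) ^ 2 = lam t ^ 2 * V t := by
        rw [hV, Finset.mul_sum]; exact Finset.sum_congr rfl fun j _ => by ring
      rw [e3] at e1
      rw [e4] at e2
      have e5 : ∑ σ : ι → Bool, F σ t ≤
          2 * (2 ^ Fintype.card ι * Real.exp (lam t ^ 2 * V t / 2)) := by
        rw [hF, Finset.sum_add_distrib]; linarith
      calc W t * ∑ σ : ι → Bool, F σ t
          ≤ W t * (2 * (2 ^ Fintype.card ι * Real.exp (lam t ^ 2 * V t / 2))) := by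
            gcongr
        _ = 2 ^ Fintype.card ι * (2 * (W t * Real.exp (lam t ^ 2 * V t / 2))) := by ring
        _ = _ := by
          rw [hW, ← Real.exp_add]; congr 3; ring_nf
    refine (Finset.sum_le_sum h1).trans_lt ?_
    rw [← Finset.mul_sum]
    simp only [Finset.sum_const, Finset.card_univ, Fintype.card_fun, Fintype.card_bool,
      nsmul_eq_mul, mul_one]
    push_cast
    nlinarith [pow_pos (two_pos : (0 : ℝ) < 2) (Fintype.card ι)]
  obtain ⟨σ, -, hσ⟩ := Finset.exists_lt_of_sum_lt havg
  refine ⟨σ, fun t ht => ?_⟩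
  -- When `V t = 0`, `lam t` is zero by the convention for division by zero and carries no
  -- information, but then all coefficients vanish.
  rcases (hV0 t).eq_or_lt with h0 | hpos
  · have hz : ∀ j, a t j = 0 := fun j => by
      have := (Finset.sum_eq_zero_iff_of_nonneg (fun j _ => sq_nonneg (a t j))).1 h0.symm j
        (Finset.mem_univ j)
      simpa using this
    simp [hz]
  have hFt : W t * F σ t < 1 := (Finset.single_le_sum (f := fun t => W t * F σ t)
    (fun t _ => by positivity) ht).trans_lt hσ
  have hBt := hB t ht
  have hlpos : 0 < lam t := Real.sqrt_pos.2 (by positivity)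
  have hl2 : lam t ^ 2 * V t = 2 * B t := by
    rw [hlam, Real.sq_sqrt (by positivity)]; field_simp
  have hWt : W t = Real.exp (-(2 * B t)) := by
    simp only [hW, hl2]; congr 1; ring
  set S := ∑ j, boolSign (σ j) * a t j with hS
  have hF2 : F σ t = Real.exp (lam t * S) + Real.exp (-lam t * S) := by
    simp only [hF, hS, Finset.mul_sum]
    congr 2 <;> exact Finset.sum_congr rfl fun j _ => by ring
  have hb : lam t * |S| ≤ 2 * B t := by
    have h1 : Real.exp (lam t * |S|) ≤ F σ t := by
      rw [hF2]
      rcases abs_cases S with ⟨h, -⟩ | ⟨h, -⟩ <;> rw [h]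
      · linarith [Real.exp_pos (-lam t * S)]
      · rw [mul_neg, ← neg_mul]; linarith [Real.exp_pos (lam t * S)]
    have h2 : Real.exp (-(2 * B t) + lam t * |S|) < Real.exp 0 := by
      rw [Real.exp_add, Real.exp_zero, ← hWt]
      refine lt_of_le_of_lt ?_ hFt
      gcongr
    have := Real.exp_lt_exp.1 h2
    linarith
  have hkey : |S| ^ 2 ≤ 2 * B t * V t := by
    have h3 : (lam t * |S|) ^ 2 ≤ (2 * B t) ^ 2 := by gcongr
    have h4 : lam t ^ 2 * |S| ^ 2 ≤ lam t ^ 2 * (2 * B t * V t) := by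
      have : lam t ^ 2 * (2 * B t * V t) = (2 * B t) * (lam t ^ 2 * V t) := by ring
      rw [this, hl2]; nlinarith
    exact le_of_mul_le_mul_left h4 (by positivity)
  exact Real.le_sqrt_of_sq_le hkey

/-! ### Dyadic level decomposition of the `q`-th power. -/

lemma abs_rpow_sub_rpow_le {q S x y : ℝ} (hq : 1 ≤ q) (hx : x ∈ Set.Icc 0 S)
    (hy : y ∈ Set.Icc 0 S) : |x ^ q - y ^ q| ≤ q * S ^ (q - 1) * |x - y| := by
  have h := (convex_Icc (0 : ℝ) S).norm_image_sub_le_of_norm_hasDerivWithin_le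
    (f := fun z => z ^ q) (f' := fun z => q * z ^ (q - 1)) (C := q * S ^ (q - 1))
    (fun z _ => (Real.hasDerivAt_rpow_const (Or.inr hq)).hasDerivWithinAt)
    (fun z hz => by
      rw [Real.norm_of_nonneg (mul_nonneg (by linarith) (Real.rpow_nonneg hz.1 _))]
      have := Real.rpow_le_rpow hz.1 hz.2 (by linarith : 0 ≤ q - 1)
      gcongr) hy hx
  simpa [Real.norm_eq_abs] using h

/-- The part of `a ^ q` carried by the level `[s / 2, s]`. -/
noncomputable def levelPiece (q s a : ℝ) : ℝ := min a s ^ q - min a (s / 2) ^ q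

lemma levelPiece_nonneg {q s a : ℝ} (hq : 1 ≤ q) (hs : 0 < s) (ha : 0 ≤ a) :
    0 ≤ levelPiece q s a := by
  have : min a (s / 2) ≤ min a s := min_le_min_left _ (by linarith)
  exact sub_nonneg.2 (Real.rpow_le_rpow (le_min ha (by linarith)) this (by linarith))

/-- The piece is at most `s ^ q` and at most `a ^ q`. The product of the two bounds controls the
variance on a level by `s ^ q` times a sum of `q`-th powers. -/
lemma levelPiece_sq_le {q s a : ℝ} (hq : 1 ≤ q) (hs : 0 < s) (ha : 0 ≤ a) :
    levelPiece q s a ^ 2 ≤ s ^ q * a ^ q := by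
  have h0 := levelPiece_nonneg hq hs ha
  have hm : 0 ≤ min a s := le_min ha hs.le
  have h2 : 0 ≤ min a (s / 2) ^ q := Real.rpow_nonneg (le_min ha (by linarith)) _
  have h1 : levelPiece q s a ≤ s ^ q := by
    have := Real.rpow_le_rpow hm (min_le_right a s) (by linarith : 0 ≤ q)
    unfold levelPiece; linarith
  have h3 : levelPiece q s a ≤ a ^ q := by
    have := Real.rpow_le_rpow hm (min_le_left a s) (by linarith : 0 ≤ q)
    unfold levelPiece; linarith
  rw [sq]
  exact mul_le_mul h1 h3 h0 (Real.rpow_nonneg hs.le _)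

/-- Both pieces vanish unless one argument exceeds `s / 2`, and then the Lipschitz constant times
`s` is comparable to `(s / 2) ^ q ≤ a ^ q + b ^ q`. The factor `a ^ q + b ^ q` lets net errors be
summed over all points without counting them. -/
lemma abs_levelPiece_sub_le {q s a b : ℝ} (hq : 1 ≤ q) (hs : 0 < s) (ha : 0 ≤ a) (hb : 0 ≤ b) :
    |levelPiece q s a - levelPiece q s b| ≤
      q * 2 ^ q * (|a - b| / s) * (a ^ q + b ^ q) := by
  have hclamp : ∀ x : ℝ, levelPiece q s x = max (min x s) (s / 2) ^ q - (s / 2) ^ q := by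
    intro x
    unfold levelPiece
    rcases le_total x (s / 2) with h | h
    · rw [min_eq_left h, min_eq_left (h.trans (by linarith)), max_eq_right h]; ring
    · rw [min_eq_right h, max_eq_left (le_min h (by linarith))]
  have hA : 0 ≤ a ^ q := Real.rpow_nonneg ha _
  have hB : 0 ≤ b ^ q := Real.rpow_nonneg hb _
  by_cases hab : a ≤ s / 2 ∧ b ≤ s / 2
  · have hz : ∀ x, x ≤ s / 2 → levelPiece q s x = 0 := fun x hx => by
      unfold levelPiece
      rw [min_eq_left hx, min_eq_left (hx.trans (by linarith)), sub_self]
    rw [hz a hab.1, hz b hab.2, sub_self, abs_zero]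
    positivity
  · have hge : (s / 2) ^ q ≤ a ^ q + b ^ q := by
      rw [not_and_or, not_le, not_le] at hab
      rcases hab with h | h
      · have := Real.rpow_le_rpow (by positivity) h.le (by linarith : 0 ≤ q)
        linarith
      · have := Real.rpow_le_rpow (by positivity) h.le (by linarith : 0 ≤ q)
        linarith
    have hmem : ∀ x, max (min x s) (s / 2) ∈ Set.Icc 0 s := fun x =>
      ⟨le_max_of_le_right (by linarith), max_le (min_le_right _ _) (by linarith)⟩
    have hlip : |max (min a s) (s / 2) - max (min b s) (s / 2)| ≤ |a - b| :=
      (abs_max_sub_max_le_abs _ _ _).trans (by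
        have := abs_min_sub_min_le_max a s b s
        simpa using this)
    rw [hclamp, hclamp, sub_sub_sub_cancel_right]
    have hspos : 0 < s ^ q := Real.rpow_pos_of_pos hs _
    calc _ ≤ q * s ^ (q - 1) * |max (min a s) (s / 2) - max (min b s) (s / 2)| :=
          abs_rpow_sub_rpow_le hq (hmem a) (hmem b)
      _ ≤ q * s ^ (q - 1) * |a - b| := by gcongr
      _ = q * 2 ^ q * (|a - b| / s) * (s / 2) ^ q := by
          rw [Real.div_rpow hs.le (by norm_num), Real.rpow_sub_one hs.ne']
          field_simp
      _ ≤ _ := by gcongr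

lemma sum_levelPiece {q M a : ℝ} (haM : a ≤ M) (L : ℕ) :
    a ^ q = (∑ i ∈ Finset.range L, levelPiece q (M * (1 / 2) ^ i) a) +
      min a (M * (1 / 2) ^ L) ^ q := by
  have h : ∀ i, levelPiece q (M * (1 / 2) ^ i) a =
      min a (M * (1 / 2) ^ i) ^ q - min a (M * (1 / 2) ^ (i + 1)) ^ q := fun i => by
    unfold levelPiece
    congr 3
    ring
  simp only [h]
  rw [Finset.sum_range_sub']
  simp [min_eq_left haM]

/-! ### Halving a point set under an entropy bound. -/

/-- The ratio of consecutive levels in the halving bound. -/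
noncomputable def levelRatio (q : ℝ) : ℝ := (1 / 2) ^ ((q - 2) / 4)

lemma levelRatio_pos (q : ℝ) : 0 < levelRatio q := Real.rpow_pos_of_pos (by norm_num) _

lemma levelRatio_lt_one {q : ℝ} (hq : 2 < q) : levelRatio q < 1 :=
  Real.rpow_lt_one (by norm_num) (by norm_num) (by linarith)

/-- The constant of the halving bound. -/
noncomputable def halvingConst (q : ℝ) : ℝ := (4 * (q * 2 ^ q) + 3) / (1 - levelRatio q) + 1

lemma halvingConst_pos {q : ℝ} (hq : 2 < q) : 0 < halvingConst q := by
  have := levelRatio_lt_one hq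
  have h2 : (0 : ℝ) < 2 ^ q := Real.rpow_pos_of_pos two_pos _
  have : 0 < 1 - levelRatio q := by linarith
  unfold halvingConst
  positivity

lemma sum_geometric_le {r : ℝ} (h0 : 0 ≤ r) (h1 : r < 1) (L : ℕ) :
    ∑ i ∈ Finset.range L, r ^ i ≤ 1 / (1 - r) := by
  rw [← tsum_geometric_of_lt_one h0 h1 |>.trans (one_div _).symm]
  exact (summable_geometric_of_lt_one h0 h1).sum_le_tsum _ fun i _ => pow_nonneg h0 i

lemma abs_sum_boolSign_mul_le {ι : Type*} [Fintype ι] (σ : ι → Bool) (a : ι → ℝ) :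
    |∑ j, boolSign (σ j) * a j| ≤ ∑ j, |a j| := by
  refine (Finset.abs_sum_le_sum_abs _ _).trans (Finset.sum_le_sum fun j _ => ?_)
  rw [abs_mul]
  cases σ j <;> simp

/-- The union bound over levels: the exponent on level `i` is at least `3 * 4 ^ i ≥ 3 (i + 1)`, so
the terms are dominated by a geometric series with sum `2 / 3`. -/
lemma sum_exp_neg_levels_lt_one {A M : ℝ} (hM : 0 < M) (hA : 3 * M ^ 2 ≤ A) {δ : ℕ → ℝ}
    (hδ0 : ∀ i, 0 < δ i) (hδ1 : ∀ i, δ i ≤ 1) (L : ℕ) :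
    ∑ i ∈ Finset.range L, 2 * Real.exp (-(A / (δ i * (M * (1 / 2) ^ i)) ^ 2)) < 1 := by
  have hterm : ∀ i, 2 * Real.exp (-(A / (δ i * (M * (1 / 2) ^ i)) ^ 2)) ≤
      2 * (1 / 4) * (1 / 4) ^ i := by
    intro i
    have hpos : 0 < δ i * (M * (1 / 2) ^ i) := mul_pos (hδ0 i) (by positivity)
    have h1 : 3 * ((i : ℝ) + 1) ≤ A / (δ i * (M * (1 / 2) ^ i)) ^ 2 := by
      rw [le_div_iff₀ (by positivity)]
      have h2 : (δ i * (M * (1 / 2) ^ i)) ^ 2 ≤ (1 * (M * (1 / 2) ^ i)) ^ 2 := by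
        have := hδ1 i
        gcongr
      have h3 : ((i : ℝ) + 1) * (1 / 4) ^ i ≤ 1 := by
        have h4 := one_add_mul_le_pow (by norm_num : (-2 : ℝ) ≤ 3) i
        have h5 : (1 / 4 : ℝ) ^ i * 4 ^ i = 1 := by rw [← mul_pow]; norm_num
        have h6 : (i : ℝ) + 1 ≤ 4 ^ i := by
          refine le_trans ?_ (h4.trans (by norm_num))
          have : (0 : ℝ) ≤ i := Nat.cast_nonneg i
          linarith
        have h7 : (0 : ℝ) < (1 / 4) ^ i := by positivity
        nlinarith
      calc 3 * ((i : ℝ) + 1) * (δ i * (M * (1 / 2) ^ i)) ^ 2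
          ≤ 3 * ((i : ℝ) + 1) * (1 * (M * (1 / 2) ^ i)) ^ 2 := by gcongr
        _ = 3 * M ^ 2 * (((i : ℝ) + 1) * (1 / 4) ^ i) := by
            rw [one_mul, mul_pow, ← pow_mul, mul_comm i 2, pow_mul]; norm_num; ring
        _ ≤ 3 * M ^ 2 * 1 := by gcongr
        _ ≤ A := by linarith
    have h4 : Real.exp (-3 : ℝ) ≤ 1 / 4 := by
      rw [Real.exp_neg, one_div]
      apply inv_anti₀ (by norm_num)
      have := Real.add_one_le_exp (3 : ℝ)
      linarith
    calc 2 * Real.exp (-(A / (δ i * (M * (1 / 2) ^ i)) ^ 2))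
        ≤ 2 * Real.exp (((i + 1 : ℕ) : ℝ) * -3) := by
          gcongr
          push_cast
          linarith
      _ = 2 * Real.exp (-3) ^ (i + 1) := by rw [Real.exp_nat_mul]
      _ ≤ 2 * (1 / 4) ^ (i + 1) := by gcongr
      _ = _ := by rw [pow_succ]; ring
  calc _ ≤ ∑ i ∈ Finset.range L, 2 * (1 / 4) * (1 / 4 : ℝ) ^ i :=
        Finset.sum_le_sum fun i _ => hterm i
    _ = 2 * (1 / 4) * ∑ i ∈ Finset.range L, (1 / 4 : ℝ) ^ i := by rw [Finset.mul_sum]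
    _ ≤ 2 * (1 / 4) * (1 / (1 - 1 / 4)) := by
        gcongr
        exact sum_geometric_le (by norm_num) (by norm_num) L
    _ < 1 := by norm_num

/-- Halving under an entropy bound of order `A / s²`: one of the two points of each pair can be
selected so that the `q`-th power sums over the selected and over the rejected points nearly agree,
uniformly over the class. -/
theorem exists_halving_of_entropy {q : ℝ} (hq : 2 < q) {α ι : Type*} [Fintype ι] (K : Set α)
    (h : α → ι → Bool → ℝ) {M A n x : ℝ} (hM : 0 < M) (hn : 2 * (Fintype.card ι : ℝ) = n)
    (hA : 3 * M ^ 2 ≤ A) (hx0 : 0 < x) (hx1 : x ≤ 1) (hx : A * M ^ (q - 2) = n * x ^ 4)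
    (h0 : ∀ c ∈ K, ∀ j b, 0 ≤ h c j b) (hb : ∀ c ∈ K, ∀ j b, h c j b ≤ M)
    (hsum : ∀ c ∈ K, ∑ j, (h c j true ^ q + h c j false ^ q) ≤ 2 * n)
    (hnet : ∀ s, 0 < s → s ≤ M → ∃ T : Finset α, ↑T ⊆ K ∧ (T.card : ℝ) ≤ Real.exp (A / s ^ 2) ∧
      ∀ c ∈ K, ∃ g ∈ T, ∀ j b, |h c j b - h g j b| ≤ s) :
    ∃ σ : ι → Bool, ∀ c ∈ K,
      |∑ j, boolSign (σ j) * (h c j true ^ q - h c j false ^ q)| ≤ halvingConst q * n * x := by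
  have hq1 : 1 ≤ q := by linarith
  have hn0 : 0 ≤ n := by rw [← hn]; positivity
  have h2q : (0 : ℝ) < 2 ^ q := Real.rpow_pos_of_pos two_pos _
  have hApos : 0 < A := by nlinarith [pow_pos hM 2]
  set ρ := levelRatio q with hρ
  have hρ0 : 0 < ρ := levelRatio_pos q
  have hρ1 : ρ < 1 := levelRatio_lt_one hq
  set s : ℕ → ℝ := fun i => M * (1 / 2) ^ i with hs
  have hspos : ∀ i, 0 < s i := fun i => by positivity
  have hsM : ∀ i, s i ≤ M := fun i =>
    mul_le_of_le_one_right hM.le (pow_le_one₀ (by norm_num) (by norm_num))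
  -- The relative mesh of the net on level `i`. Since `A * s i ^ (q - 2) = n * δ i ^ 4`, it balances
  -- the approximation error `n * δ i` against the random error `√(n * A * s i ^ (q - 2)) / δ i`, up
  -- to constants.
  set δ : ℕ → ℝ := fun i => x * ρ ^ i with hδ
  have hδ0 : ∀ i, 0 < δ i := fun i => by positivity
  have hδ1 : ∀ i, δ i ≤ 1 := fun i =>
    mul_le_one₀ hx1 (by positivity) (pow_le_one₀ hρ0.le hρ1.le)
  have hspow : ∀ i, A * s i ^ (q - 2) = n * x ^ 4 * (ρ ^ i) ^ 4 := by
    intro i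
    rw [← hx, hs, Real.mul_rpow hM.le (by positivity), hρ, levelRatio, ← Real.rpow_natCast,
      ← Real.rpow_natCast, ← Real.rpow_natCast, ← Real.rpow_mul (by positivity),
      ← Real.rpow_mul (by positivity), ← Real.rpow_mul (by positivity)]
    rw [mul_assoc]
    congr 3
    push_cast
    ring
  -- Below level `L` each pair contributes at most `x`, so the decomposition can stop there.
  obtain ⟨L, hL⟩ : ∃ L : ℕ, s L ^ q ≤ x := by
    obtain ⟨L, hL⟩ := exists_pow_lt_of_lt_one
      (div_pos (Real.rpow_pos_of_pos hx0 q⁻¹) hM) (by norm_num : (1 / 2 : ℝ) < 1)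
    refine ⟨L, ?_⟩
    rw [lt_div_iff₀ hM, mul_comm] at hL
    calc s L ^ q ≤ (x ^ q⁻¹) ^ q := Real.rpow_le_rpow (hspos L).le hL.le (by linarith)
      _ = x := Real.rpow_inv_rpow hx0.le (by linarith)
  have hnet' : ∀ i, ∃ T : Finset α, ↑T ⊆ K ∧
      (T.card : ℝ) ≤ Real.exp (A / (δ i * s i) ^ 2) ∧
      ∀ c ∈ K, ∃ g ∈ T, ∀ j b, |h c j b - h g j b| ≤ δ i * s i := fun i =>
    hnet _ (mul_pos (hδ0 i) (hspos i))
      ((mul_le_of_le_one_left (hspos i).le (hδ1 i)).trans (hsM i))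
  choose T hTK hTcard hTnet using hnet'
  set a : (Σ _ : ℕ, α) → ι → ℝ := fun t j =>
    levelPiece q (s t.1) (h t.2 j true) - levelPiece q (s t.1) (h t.2 j false) with ha
  obtain ⟨σ, hσ⟩ := exists_signs ((Finset.range L).sigma T) a
    (fun t => 2 * (A / (δ t.1 * s t.1) ^ 2))
    (fun t _ => by have := hδ0 t.1; have := hspos t.1; positivity) (by
      rw [Finset.sum_sigma]
      refine lt_of_le_of_lt (Finset.sum_le_sum fun i _ => ?_)
        (sum_exp_neg_levels_lt_one hM hA hδ0 hδ1 L)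
      simp only [Finset.sum_const, nsmul_eq_mul]
      calc (T i).card * (2 * Real.exp (-(2 * (A / (δ i * s i) ^ 2))))
          ≤ Real.exp (A / (δ i * s i) ^ 2) * (2 * Real.exp (-(2 * (A / (δ i * s i) ^ 2)))) := by
            gcongr
            exact hTcard i
        _ = 2 * Real.exp (-(A / (δ i * s i) ^ 2)) := by
            rw [mul_left_comm, ← Real.exp_add]; congr 2; ring)
  refine ⟨σ, fun c hc => ?_⟩
  have hlevel : ∀ i ∈ Finset.range L,
      |∑ j, boolSign (σ j) * (levelPiece q (s i) (h c j true) - levelPiece q (s i) (h c j false))|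
        ≤ (4 * (q * 2 ^ q) + 3) * n * x * ρ ^ i := by
    intro i hi
    obtain ⟨g, hgT, hg⟩ := hTnet i c hc
    have hgK : g ∈ K := hTK i hgT
    have hdiff : ∀ j b, |levelPiece q (s i) (h c j b) - levelPiece q (s i) (h g j b)| ≤
        q * 2 ^ q * δ i * (h c j b ^ q + h g j b ^ q) := by
      intro j b
      refine (abs_levelPiece_sub_le hq1 (hspos i) (h0 c hc j b) (h0 g hgK j b)).trans ?_
      have h1 : |h c j b - h g j b| / s i ≤ δ i := by
        rw [div_le_iff₀ (hspos i)]; exact hg j b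
      have h2 : 0 ≤ h c j b ^ q + h g j b ^ q :=
        add_nonneg (Real.rpow_nonneg (h0 c hc j b) _) (Real.rpow_nonneg (h0 g hgK j b) _)
      gcongr
    have hfirst : |∑ j, boolSign (σ j) *
        ((levelPiece q (s i) (h c j true) - levelPiece q (s i) (h c j false)) - a ⟨i, g⟩ j)| ≤
          4 * (q * 2 ^ q) * n * x * ρ ^ i := by
      refine (abs_sum_boolSign_mul_le σ _).trans ?_
      have h1 : ∀ j, |(levelPiece q (s i) (h c j true) - levelPiece q (s i) (h c j false)) -
          a ⟨i, g⟩ j| ≤ q * 2 ^ q * δ i * ((h c j true ^ q + h c j false ^ q) +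
            (h g j true ^ q + h g j false ^ q)) := by
        intro j
        have e1 := hdiff j true
        have e2 := hdiff j false
        have e3 := abs_sub (levelPiece q (s i) (h c j true) - levelPiece q (s i) (h g j true))
          (levelPiece q (s i) (h c j false) - levelPiece q (s i) (h g j false))
        have e4 : (levelPiece q (s i) (h c j true) - levelPiece q (s i) (h c j false)) -
          a ⟨i, g⟩ j = (levelPiece q (s i) (h c j true) - levelPiece q (s i) (h g j true)) -
          (levelPiece q (s i) (h c j false) - levelPiece q (s i) (h g j false)) := by
          simp only [ha]; ring
        rw [e4]
        linarith
      refine (Finset.sum_le_sum fun j _ => h1 j).trans ?_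
      rw [← Finset.mul_sum, Finset.sum_add_distrib]
      have h2 := hsum c hc
      have h3 := hsum g hgK
      have h4 : 0 ≤ q * 2 ^ q * δ i := by have := hδ0 i; positivity
      calc _ ≤ q * 2 ^ q * δ i * (2 * n + 2 * n) := by gcongr
        _ = _ := by simp only [hδ]; ring
    -- The coefficients are differences of nonnegative pieces, so their squares are at most the sum
    -- of the two squares. The deviation is then `√8 * n * x * ρ ^ i`.
    have hsecond : |∑ j, boolSign (σ j) * a ⟨i, g⟩ j| ≤ 3 * n * x * ρ ^ i := by
      refine (hσ ⟨i, g⟩ (Finset.mem_sigma.2 ⟨hi, hgT⟩)).trans ?_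
      refine Real.sqrt_le_iff.2 ⟨by positivity, ?_⟩
      have h1 : ∑ j, a ⟨i, g⟩ j ^ 2 ≤ s i ^ q * (2 * n) := by
        refine le_trans ?_ (mul_le_mul_of_nonneg_left (hsum g hgK)
          (Real.rpow_nonneg (hspos i).le _))
        rw [Finset.mul_sum]
        refine Finset.sum_le_sum fun j _ => ?_
        have e1 := levelPiece_sq_le hq1 (hspos i) (h0 g hgK j true)
        have e2 := levelPiece_sq_le hq1 (hspos i) (h0 g hgK j false)
        have e3 := mul_nonneg (levelPiece_nonneg hq1 (hspos i) (h0 g hgK j true))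
          (levelPiece_nonneg hq1 (hspos i) (h0 g hgK j false))
        simp only [ha]
        nlinarith
      have hδi := hδ0 i
      have hsi := hspos i
      calc 2 * (2 * (A / (δ i * s i) ^ 2)) * ∑ j, a ⟨i, g⟩ j ^ 2
          ≤ 2 * (2 * (A / (δ i * s i) ^ 2)) * (s i ^ q * (2 * n)) := by gcongr
        _ = 8 * n * (A * s i ^ (q - 2)) / δ i ^ 2 := by
            rw [Real.rpow_sub hsi, Real.rpow_two]
            field_simp
            ring
        _ = 8 * (n * x * ρ ^ i) ^ 2 := by
            rw [hspow]
            simp only [hδ]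
            field_simp
        _ ≤ (3 * n * x * ρ ^ i) ^ 2 := by nlinarith [sq_nonneg (n * x * ρ ^ i)]
    have hsplit : ∑ j, boolSign (σ j) *
        (levelPiece q (s i) (h c j true) - levelPiece q (s i) (h c j false)) =
        (∑ j, boolSign (σ j) * ((levelPiece q (s i) (h c j true) -
          levelPiece q (s i) (h c j false)) - a ⟨i, g⟩ j)) +
        ∑ j, boolSign (σ j) * a ⟨i, g⟩ j := by
      rw [← Finset.sum_add_distrib]
      exact Finset.sum_congr rfl fun j _ => by ring
    rw [hsplit]
    refine (abs_add_le _ _).trans ?_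
    linarith
  have hlow : |∑ j, boolSign (σ j) * (min (h c j true) (s L) ^ q - min (h c j false) (s L) ^ q)| ≤
      n * x := by
    refine (abs_sum_boolSign_mul_le σ _).trans ?_
    have h1 : ∀ j, |min (h c j true) (s L) ^ q - min (h c j false) (s L) ^ q| ≤ x := by
      intro j
      have hmem : ∀ b, 0 ≤ min (h c j b) (s L) ^ q ∧ min (h c j b) (s L) ^ q ≤ x := fun b =>
        ⟨Real.rpow_nonneg (le_min (h0 c hc j b) (hspos L).le) _,
          (Real.rpow_le_rpow (le_min (h0 c hc j b) (hspos L).le) (min_le_right _ _)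
            (by linarith)).trans hL⟩
      rw [abs_le]
      constructor <;> linarith [(hmem true).1, (hmem true).2, (hmem false).1, (hmem false).2]
    refine (Finset.sum_le_sum fun j _ => h1 j).trans ?_
    rw [Finset.sum_const, Finset.card_univ, nsmul_eq_mul]
    gcongr
    rw [← hn]
    have : (0 : ℝ) ≤ Fintype.card ι := Nat.cast_nonneg _
    linarith
  have hdecomp : ∑ j, boolSign (σ j) * (h c j true ^ q - h c j false ^ q) =
      (∑ i ∈ Finset.range L, ∑ j, boolSign (σ j) *
        (levelPiece q (s i) (h c j true) - levelPiece q (s i) (h c j false))) +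
      ∑ j, boolSign (σ j) * (min (h c j true) (s L) ^ q - min (h c j false) (s L) ^ q) := by
    rw [Finset.sum_comm, ← Finset.sum_add_distrib]
    refine Finset.sum_congr rfl fun j _ => ?_
    rw [← Finset.mul_sum, ← mul_add, Finset.sum_sub_distrib]
    congr 1
    rw [sum_levelPiece (q := q) (hb c hc j true) L, sum_levelPiece (q := q) (hb c hc j false) L]
    ring
  rw [hdecomp]
  refine (abs_add_le _ _).trans ?_
  have hfin : |∑ i ∈ Finset.range L, ∑ j, boolSign (σ j) *
        (levelPiece q (s i) (h c j true) - levelPiece q (s i) (h c j false))| ≤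
      (4 * (q * 2 ^ q) + 3) * n * x * (1 / (1 - ρ)) := by
    refine (Finset.abs_sum_le_sum_abs _ _).trans ((Finset.sum_le_sum hlevel).trans ?_)
    rw [← Finset.mul_sum]
    gcongr
    exact sum_geometric_le hρ0.le hρ1 L
  have hconst : halvingConst q * n * x =
      (4 * (q * 2 ^ q) + 3) * n * x * (1 / (1 - ρ)) + n * x := by
    rw [halvingConst, ← hρ]; ring
  rw [hconst]
  linarith

/-! ### The noncommutative Khintchine inequality for trace moments. -/

section NoncommutativeKhintchine

open Matrix

open scoped ComplexOrder

/-- The Rademacher sum with matrix coefficients. -/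
noncomputable def signedSum {𝕜 n ι : Type*} [RCLike 𝕜] [Fintype ι]
    (A : ι → Matrix n n 𝕜) (σ : ι → Bool) : Matrix n n 𝕜 :=
  ∑ j, boolSign (σ j) • A j

lemma signedSum_isHermitian {𝕜 n ι : Type*} [RCLike 𝕜] [Fintype ι] {A : ι → Matrix n n 𝕜}
    (hA : ∀ j, (A j).IsHermitian) (σ : ι → Bool) : (signedSum A σ).IsHermitian := by
  unfold signedSum Matrix.IsHermitian
  rw [conjTranspose_sum]
  refine Finset.sum_congr rfl fun j _ => ?_
  rw [conjTranspose_smul, (hA j).eq, star_trivial]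

/-- Reversal of one sign. -/
def flipSign {ι : Type*} [DecidableEq ι] (j : ι) : Equiv.Perm (ι → Bool) :=
  Function.Involutive.toPerm (fun σ => Function.update σ j (!σ j)) fun σ => by simp

lemma flipSign_apply_self {ι : Type*} [DecidableEq ι] (j : ι) (σ : ι → Bool) :
    flipSign j σ j = !σ j := by
  simp [flipSign, Function.Involutive.toPerm]

lemma signedSum_sub_flip {𝕜 n ι : Type*} [RCLike 𝕜] [Fintype ι] [DecidableEq ι]
    (A : ι → Matrix n n 𝕜)
    (σ : ι → Bool) (j : ι) :
    signedSum A σ - signedSum A (flipSign j σ) = (2 * boolSign (σ j)) • A j := by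
  unfold signedSum
  rw [← Finset.sum_sub_distrib, Finset.sum_eq_single j]
  · rw [flipSign_apply_self, ← sub_smul]
    congr 1
    cases σ j <;> simp <;> norm_num
  · intro i _ hij
    have : flipSign j σ i = σ i := by
      simp [flipSign, Function.Involutive.toPerm, Function.update_of_ne hij]
    rw [this, sub_self]
  · simp

variable {𝕜 n : Type*} [RCLike 𝕜] [Fintype n] [DecidableEq n]

lemma Matrix.IsHermitian.exists_pow_eq {A : Matrix n n 𝕜} (hA : A.IsHermitian) :
    ∃ (U : Matrix n n 𝕜) (l : n → ℝ), Uᴴ * U = 1 ∧ U * Uᴴ = 1 ∧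
      ∀ k : ℕ, A ^ k = U * diagonal (fun i => ((l i ^ k : ℝ) : 𝕜)) * Uᴴ := by
  refine ⟨hA.eigenvectorUnitary, hA.eigenvalues, Unitary.coe_star_mul_self _,
    Unitary.coe_mul_star_self _, fun k => ?_⟩
  conv_lhs => rw [hA.spectral_theorem]
  rw [← map_pow, diagonal_pow, Unitary.conjStarAlgAut_apply]
  congr 3
  ext i
  simp

/-- Joint spectral form of the traces `tr (H Wᵏ H Yˡ)`. -/
lemma exists_trace_mul_pow_mul_pow {W Y H : Matrix n n 𝕜} (hW : W.IsHermitian)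
    (hY : Y.IsHermitian) (hH : H.IsHermitian) :
    ∃ (a b : n → ℝ) (c : n → n → ℝ), (∀ i j, 0 ≤ c i j) ∧
      ∀ k l : ℕ, RCLike.re (trace (H * W ^ k * H * Y ^ l)) =
        ∑ i, ∑ j, a i ^ k * b j ^ l * c i j := by
  obtain ⟨U, a, -, -, hU⟩ := hW.exists_pow_eq
  obtain ⟨Q, b, -, -, hQ⟩ := hY.exists_pow_eq
  refine ⟨a, b, fun i j => ‖(Uᴴ * H * Q) i j‖ ^ 2, fun i j => by positivity, fun k l => ?_⟩
  set G := Uᴴ * H * Q with hG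
  have hGs : Gᴴ = Qᴴ * H * U := by
    rw [hG, conjTranspose_mul, conjTranspose_mul, conjTranspose_conjTranspose, hH.eq, mul_assoc]
  have h1 : trace (H * W ^ k * H * Y ^ l) =
      trace (Gᴴ * diagonal (fun i => ((a i ^ k : ℝ) : 𝕜)) * G *
        diagonal (fun i => ((b i ^ l : ℝ) : 𝕜))) := by
    rw [hU, hQ, hGs, hG]
    calc _ = trace ((H * U * diagonal (fun i => ((a i ^ k : ℝ) : 𝕜)) * Uᴴ * H * Q *
          diagonal (fun i => ((b i ^ l : ℝ) : 𝕜))) * Qᴴ) := by simp only [mul_assoc]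
      _ = trace (Qᴴ * (H * U * diagonal (fun i => ((a i ^ k : ℝ) : 𝕜)) * Uᴴ * H * Q *
          diagonal (fun i => ((b i ^ l : ℝ) : 𝕜)))) := trace_mul_comm _ _
      _ = _ := by simp only [mul_assoc]
  rw [h1]
  simp only [trace, diag_apply, mul_diagonal]
  rw [Finset.sum_comm, map_sum]
  refine Finset.sum_congr rfl fun j _ => ?_
  rw [mul_apply, Finset.sum_mul, map_sum]
  refine Finset.sum_congr rfl fun i _ => ?_
  rw [mul_diagonal, conjTranspose_apply]
  have h2 : star (G i j) * ((a i ^ k : ℝ) : 𝕜) * G i j * ((b j ^ l : ℝ) : 𝕜) =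
      ((a i ^ k * b j ^ l * ‖G i j‖ ^ 2 : ℝ) : 𝕜) := by
    have h3 : star (G i j) * G i j = ((‖G i j‖ ^ 2 : ℝ) : 𝕜) := by
      rw [RCLike.star_def, RCLike.conj_mul]; push_cast; rfl
    rw [mul_right_comm (star (G i j)), h3]
    push_cast
    ring
  rw [h2, RCLike.ofReal_re]

/-- The exponents `k` and `2 * r - k` are paired. With `l = 2 * r - k`, the differences `|x| ^ k -
|y| ^ k` and `|x| ^ l - |y| ^ l` never have opposite signs, so each pair is at most `x ^ (2 * r) + y
^ (2 * r)`. -/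
lemma sum_pow_mul_pow_le (x y : ℝ) (r : ℕ) :
    ∑ k ∈ Finset.range (2 * r + 1), x ^ k * y ^ (2 * r - k) ≤
      (2 * r + 1) / 2 * (x ^ (2 * r) + y ^ (2 * r)) := by
  have hpair : ∀ k ∈ Finset.range (2 * r + 1),
      x ^ k * y ^ (2 * r - k) + x ^ (2 * r - k) * y ^ k ≤ x ^ (2 * r) + y ^ (2 * r) := by
    intro k hk
    have hk' : k ≤ 2 * r := Nat.lt_succ_iff.1 (Finset.mem_range.1 hk)
    obtain ⟨l, hl⟩ := Nat.exists_eq_add_of_le hk'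
    have e1 : ∀ z : ℝ, z ^ (2 * r) = |z| ^ k * |z| ^ l := fun z => by
      rw [← pow_add, ← hl, pow_mul, pow_mul, sq_abs]
    have e2 : 2 * r - k = l := by omega
    rw [e1, e1, e2]
    have h1 : x ^ k * y ^ l ≤ |x| ^ k * |y| ^ l := by
      rw [← abs_pow, ← abs_pow, ← abs_mul]; exact le_abs_self _
    have h2 : x ^ l * y ^ k ≤ |x| ^ l * |y| ^ k := by
      rw [← abs_pow, ← abs_pow, ← abs_mul]; exact le_abs_self _
    have h3 : 0 ≤ (|x| ^ k - |y| ^ k) * (|x| ^ l - |y| ^ l) := by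
      rcases le_total |x| |y| with h | h
      · exact mul_nonneg_of_nonpos_of_nonpos
          (sub_nonpos.2 (pow_le_pow_left₀ (abs_nonneg _) h _))
          (sub_nonpos.2 (pow_le_pow_left₀ (abs_nonneg _) h _))
      · exact mul_nonneg (sub_nonneg.2 (pow_le_pow_left₀ (abs_nonneg _) h _))
          (sub_nonneg.2 (pow_le_pow_left₀ (abs_nonneg _) h _))
    nlinarith
  have hsum := Finset.sum_le_sum hpair
  rw [Finset.sum_add_distrib, Finset.sum_const, Finset.card_range, nsmul_eq_mul] at hsum
  have hrefl : ∑ k ∈ Finset.range (2 * r + 1), x ^ (2 * r - k) * y ^ k =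
      ∑ k ∈ Finset.range (2 * r + 1), x ^ k * y ^ (2 * r - k) := by
    rw [← Finset.sum_range_reflect]
    refine Finset.sum_congr rfl fun k hk => ?_
    have hk' : k < 2 * r + 1 := Finset.mem_range.1 hk
    congr 2
    · omega
  rw [hrefl] at hsum
  push_cast at hsum
  linarith

/-- The Heinz-type inequality behind the noncommutative Khintchine inequality. -/
lemma re_trace_sum_mul_pow_mul_pow_le {W Y H : Matrix n n 𝕜} (hW : W.IsHermitian)
    (hY : Y.IsHermitian) (hH : H.IsHermitian) (r : ℕ) :
    ∑ k ∈ Finset.range (2 * r + 1), RCLike.re (trace (H * W ^ k * H * Y ^ (2 * r - k))) ≤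
      (2 * r + 1) / 2 * (RCLike.re (trace (H * H * W ^ (2 * r))) +
        RCLike.re (trace (H * H * Y ^ (2 * r)))) := by
  obtain ⟨a, b, c, hc, h⟩ := exists_trace_mul_pow_mul_pow hW hY hH
  have h1 : RCLike.re (trace (H * H * W ^ (2 * r))) =
      ∑ i, ∑ j, a i ^ (2 * r) * b j ^ 0 * c i j := by
    rw [← h, pow_zero, mul_one, mul_assoc H H, trace_mul_comm H]
  have h2 : RCLike.re (trace (H * H * Y ^ (2 * r))) =
      ∑ i, ∑ j, a i ^ 0 * b j ^ (2 * r) * c i j := by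
    rw [← h, pow_zero, mul_one]
  rw [h1, h2]
  simp only [h]
  rw [Finset.sum_comm, ← Finset.sum_add_distrib, Finset.mul_sum]
  refine Finset.sum_le_sum fun i _ => ?_
  rw [Finset.sum_comm, ← Finset.sum_add_distrib, Finset.mul_sum]
  refine Finset.sum_le_sum fun j _ => ?_
  rw [← Finset.sum_mul]
  have := mul_le_mul_of_nonneg_right (sum_pow_mul_pow_le (a i) (b j) r) (hc i j)
  refine this.trans (le_of_eq ?_)
  ring

/-- Telescoping that respects noncommutativity: `x - y` stays in the middle, where it becomes a
multiple of one coefficient when a single sign is flipped. -/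
lemma pow_succ_sub_pow_succ {R : Type*} [Ring R] (x y : R) (m : ℕ) :
    x ^ (m + 1) - y ^ (m + 1) =
      ∑ k ∈ Finset.range (m + 1), x ^ k * (x - y) * y ^ (m - k) := by
  have h : ∀ k ∈ Finset.range (m + 1), x ^ k * (x - y) * y ^ (m - k) =
      x ^ (k + 1) * y ^ (m + 1 - (k + 1)) - x ^ k * y ^ (m + 1 - k) := by
    intro k hk
    have hk' : k ≤ m := Nat.lt_succ_iff.1 (Finset.mem_range.1 hk)
    have e1 : m + 1 - (k + 1) = m - k := by omega
    have e2 : m + 1 - k = (m - k) + 1 := by omega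
    rw [e1, e2, pow_succ x k, pow_succ' y (m - k)]
    noncomm_ring
  rw [Finset.sum_congr rfl h, Finset.sum_range_sub fun k => x ^ k * y ^ (m + 1 - k)]
  simp

lemma boolSign_not (b : Bool) : boolSign (!b) = -boolSign b := by cases b <;> simp

lemma boolSign_mul_self (b : Bool) : boolSign b * boolSign b = 1 := by cases b <;> simp

/-- One step of the noncommutative Khintchine recursion for a single coefficient. -/
lemma sum_boolSign_mul_re_trace_le {ι : Type*} [Fintype ι] [DecidableEq ι]
    {A : ι → Matrix n n 𝕜} (hA : ∀ j, (A j).IsHermitian) (r : ℕ) (j : ι) :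
    ∑ σ : ι → Bool, boolSign (σ j) * RCLike.re (trace (A j * signedSum A σ ^ (2 * r + 1))) ≤
      (2 * r + 1) * ∑ σ : ι → Bool, RCLike.re (trace (A j * A j * signedSum A σ ^ (2 * r))) := by
  set f : (ι → Bool) → ℝ := fun σ => RCLike.re (trace (A j * signedSum A σ ^ (2 * r + 1))) with hf
  set g : (ι → Bool) → ℝ := fun σ => RCLike.re (trace (A j * A j * signedSum A σ ^ (2 * r)))
    with hg
  -- A discrete integration by parts: flipping the sign `j` preserves the uniform measure, so only
  -- the change of `f` under the flip matters.
  have h1 : ∑ σ, boolSign (σ j) * f σ = -∑ σ, boolSign (σ j) * f (flipSign j σ) := by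
    rw [← Equiv.sum_comp (flipSign j), ← Finset.sum_neg_distrib]
    refine Finset.sum_congr rfl fun σ _ => ?_
    rw [flipSign_apply_self, boolSign_not, neg_mul]
  have h2 : ∑ σ, boolSign (σ j) * f σ =
      ∑ σ, 1 / 2 * (boolSign (σ j) * (f σ - f (flipSign j σ))) := by
    have : ∑ σ, 1 / 2 * (boolSign (σ j) * (f σ - f (flipSign j σ))) =
        1 / 2 * (∑ σ, boolSign (σ j) * f σ - ∑ σ, boolSign (σ j) * f (flipSign j σ)) := by
      rw [← Finset.sum_sub_distrib, Finset.mul_sum]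
      exact Finset.sum_congr rfl fun σ _ => by ring
    rw [this]
    linarith
  have h3 : ∀ σ, 1 / 2 * (boolSign (σ j) * (f σ - f (flipSign j σ))) ≤
      (2 * r + 1) / 2 * (g σ + g (flipSign j σ)) := by
    intro σ
    have e1 : f σ - f (flipSign j σ) = 2 * boolSign (σ j) *
        ∑ k ∈ Finset.range (2 * r + 1), RCLike.re (trace (A j * signedSum A σ ^ k * A j *
          signedSum A (flipSign j σ) ^ (2 * r - k))) := by
      simp only [hf]
      rw [← map_sub, ← trace_sub, ← mul_sub, pow_succ_sub_pow_succ, signedSum_sub_flip,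
        Finset.mul_sum, trace_sum, map_sum, Finset.mul_sum]
      refine Finset.sum_congr rfl fun k _ => ?_
      rw [mul_smul_comm, smul_mul_assoc, mul_smul_comm, trace_smul, RCLike.smul_re]
      simp only [mul_assoc]
    have e2 := re_trace_sum_mul_pow_mul_pow_le (signedSum_isHermitian hA σ)
      (signedSum_isHermitian hA (flipSign j σ)) (hA j) r
    rw [e1]
    have e3 := boolSign_mul_self (σ j)
    calc _ = (boolSign (σ j) * boolSign (σ j)) * ∑ k ∈ Finset.range (2 * r + 1),
          RCLike.re (trace (A j * signedSum A σ ^ k * A j *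
            signedSum A (flipSign j σ) ^ (2 * r - k))) := by ring
      _ ≤ _ := by rw [e3, one_mul]; exact e2
  rw [h2]
  refine (Finset.sum_le_sum fun σ _ => h3 σ).trans (le_of_eq ?_)
  rw [← Finset.mul_sum, Finset.sum_add_distrib, Equiv.sum_comp (flipSign j) g]
  ring

/-- Recursion for the even trace moments of a matrix Rademacher sum. -/
lemma sum_re_trace_signedSum_pow_le {ι : Type*} [Fintype ι] [DecidableEq ι] {A : ι → Matrix n n 𝕜}
    (hA : ∀ j, (A j).IsHermitian) {v : ℝ}
    (hv : (v • (1 : Matrix n n 𝕜) - ∑ j, A j * A j).PosSemidef) (r : ℕ) :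
    ∑ σ : ι → Bool, RCLike.re (trace (signedSum A σ ^ (2 * (r + 1)))) ≤
      (2 * r + 1) * v * ∑ σ : ι → Bool, RCLike.re (trace (signedSum A σ ^ (2 * r))) := by
  have h1 : ∀ σ : ι → Bool, RCLike.re (trace (signedSum A σ ^ (2 * (r + 1)))) =
      ∑ j, boolSign (σ j) * RCLike.re (trace (A j * signedSum A σ ^ (2 * r + 1))) := by
    intro σ
    rw [show 2 * (r + 1) = (2 * r + 1) + 1 by ring, pow_succ']
    conv_lhs => enter [2, 1, 1]; rw [signedSum]
    rw [Finset.sum_mul, trace_sum, map_sum]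
    refine Finset.sum_congr rfl fun j _ => ?_
    rw [smul_mul_assoc, trace_smul, RCLike.smul_re]
  -- The positive semidefinite defect is conjugated by the `r`-th power of the Hermitian sum; its
  -- trace stays nonnegative.
  have h2 : ∀ σ : ι → Bool, ∑ j, RCLike.re (trace (A j * A j * signedSum A σ ^ (2 * r))) ≤
      v * RCLike.re (trace (signedSum A σ ^ (2 * r))) := by
    intro σ
    have hP := hv.conjTranspose_mul_mul_same (signedSum A σ ^ r)
    have h0 := (RCLike.nonneg_iff.1 hP.trace_nonneg).1
    rw [((signedSum_isHermitian hA σ).pow r).eq, trace_mul_cycle, ← pow_add, ← two_mul,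
      trace_mul_comm, sub_mul, trace_sub, map_sub, smul_mul_assoc, one_mul, trace_smul,
      RCLike.smul_re, Finset.sum_mul, trace_sum, map_sum] at h0
    linarith
  simp only [h1]
  rw [Finset.sum_comm]
  refine (Finset.sum_le_sum fun j _ => sum_boolSign_mul_re_trace_le hA r j).trans ?_
  rw [← Finset.mul_sum, Finset.sum_comm, mul_assoc]
  gcongr
  rw [Finset.mul_sum]
  exact Finset.sum_le_sum fun σ _ => h2 σ

/-- Noncommutative Khintchine inequality for even trace moments. -/
lemma sum_re_trace_signedSum_pow_le_pow {ι : Type*} [Fintype ι] [DecidableEq ι]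
    {A : ι → Matrix n n 𝕜}
    (hA : ∀ j, (A j).IsHermitian) {v : ℝ} (hv0 : 0 ≤ v)
    (hv : (v • (1 : Matrix n n 𝕜) - ∑ j, A j * A j).PosSemidef) (p : ℕ) :
    ∑ σ : ι → Bool, RCLike.re (trace (signedSum A σ ^ (2 * p))) ≤
      (2 * p * v) ^ p * (2 ^ Fintype.card ι * Fintype.card n) := by
  have h : ∀ r ≤ p, ∑ σ : ι → Bool, RCLike.re (trace (signedSum A σ ^ (2 * r))) ≤
      (2 * p * v) ^ r * (2 ^ Fintype.card ι * Fintype.card n) := by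
    intro r
    induction r with
    | zero => intro _; simp
    | succ r ih =>
      intro hr
      refine (sum_re_trace_signedSum_pow_le hA hv r).trans ?_
      have h1 : (2 * r + 1 : ℝ) ≤ 2 * p := by
        have : ((r + 1 : ℕ) : ℝ) ≤ p := Nat.cast_le.2 hr
        push_cast at this
        linarith
      calc (2 * r + 1) * v * ∑ σ : ι → Bool, RCLike.re (trace (signedSum A σ ^ (2 * r)))
          ≤ (2 * r + 1) * v * ((2 * p * v) ^ r * (2 ^ Fintype.card ι * Fintype.card n)) := by
            gcongr
            exact ih (by omega)
        _ ≤ (2 * p) * v * ((2 * p * v) ^ r * (2 ^ Fintype.card ι * Fintype.card n)) := by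
            gcongr
        _ = _ := by ring
  exact h p le_rfl

lemma re_dotProduct_mulVec_of_unitary {U : Matrix n n 𝕜} (d : n → ℝ) (x : n → 𝕜) :
    RCLike.re (star x ⬝ᵥ (U * diagonal (fun i => (d i : 𝕜)) * Uᴴ) *ᵥ x) =
      ∑ i, d i * ‖(Uᴴ *ᵥ x) i‖ ^ 2 := by
  set y := Uᴴ *ᵥ x with hy
  have h1 : star x ⬝ᵥ (U * diagonal (fun i => (d i : 𝕜)) * Uᴴ) *ᵥ x =
      star y ⬝ᵥ (diagonal (fun i => (d i : 𝕜)) *ᵥ y) := by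
    rw [← mulVec_mulVec, ← mulVec_mulVec, ← hy, dotProduct_mulVec, hy, star_mulVec,
      conjTranspose_conjTranspose]
  rw [h1, dotProduct, map_sum]
  refine Finset.sum_congr rfl fun i _ => ?_
  rw [mulVec_diagonal, Pi.star_apply, mul_left_comm, RCLike.star_def, RCLike.conj_mul,
    ← RCLike.ofReal_pow, ← RCLike.ofReal_mul, RCLike.ofReal_re]

/-- Quadratic form bound from an even trace moment. -/
lemma abs_re_dotProduct_mulVec_le {S : Matrix n n 𝕜} (hS : S.IsHermitian) {p : ℕ} (hp : p ≠ 0)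
    {B : ℝ} (hB : 0 ≤ B) (htr : RCLike.re (trace (S ^ (2 * p))) ≤ B ^ (2 * p)) (x : n → 𝕜) :
    |RCLike.re (star x ⬝ᵥ S *ᵥ x)| ≤ B * ∑ i, ‖x i‖ ^ 2 := by
  obtain ⟨U, l, hU1, hU2, hU⟩ := hS.exists_pow_eq
  have hl : ∀ i, |l i| ≤ B := by
    intro i
    have h1 : RCLike.re (trace (S ^ (2 * p))) = ∑ i, l i ^ (2 * p) := by
      rw [hU, trace_mul_cycle, hU1, one_mul, trace_diagonal, map_sum]
      exact Finset.sum_congr rfl fun i _ => RCLike.ofReal_re _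
    have h2 : l i ^ (2 * p) ≤ B ^ (2 * p) := by
      refine le_trans ?_ (h1 ▸ htr)
      exact Finset.single_le_sum (f := fun i => l i ^ (2 * p))
        (fun i _ => by simp only [pow_mul]; positivity) (Finset.mem_univ i)
    have h3 : |l i| ^ (2 * p) ≤ B ^ (2 * p) := by
      rwa [pow_mul, sq_abs, ← pow_mul]
    exact le_of_pow_le_pow_left₀ (by omega) hB h3
  have hnorm : ∑ i, ‖(Uᴴ *ᵥ x) i‖ ^ 2 = ∑ i, ‖x i‖ ^ 2 := by
    have e1 := re_dotProduct_mulVec_of_unitary (U := U) (fun _ => 1) x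
    have e2 := re_dotProduct_mulVec_of_unitary (U := (1 : Matrix n n 𝕜)) (fun _ => 1) x
    simp only [RCLike.ofReal_one, diagonal_one, mul_one, one_mul, hU2, one_mulVec,
      conjTranspose_one] at e1 e2
    rw [← e1, e2]
  have hS1 : S = U * diagonal (fun i => ((l i : ℝ) : 𝕜)) * Uᴴ := by
    have := hU 1
    simpa using this
  rw [hS1, re_dotProduct_mulVec_of_unitary, ← hnorm, Finset.mul_sum]
  refine (Finset.abs_sum_le_sum_abs _ _).trans (Finset.sum_le_sum fun i _ => ?_)
  rw [abs_mul, abs_of_nonneg (by positivity : 0 ≤ ‖(Uᴴ *ᵥ x) i‖ ^ 2)]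
  exact mul_le_mul_of_nonneg_right (hl i) (by positivity)

end NoncommutativeKhintchine

/-! ### Halving for evaluation functionals on a Euclidean space. -/

section Halving

open Matrix

open scoped ComplexOrder

variable {𝕜 : Type*} [RCLike 𝕜] {d : ℕ}

lemma star_dotProduct_self (y : Fin d → 𝕜) :
    star y ⬝ᵥ y = ((‖WithLp.toLp 2 y‖ ^ 2 : ℝ) : 𝕜) := by
  rw [EuclideanSpace.norm_sq_eq, dotProduct, RCLike.ofReal_sum]
  refine Finset.sum_congr rfl fun i _ => ?_
  rw [Pi.star_apply, RCLike.star_def, RCLike.conj_mul, RCLike.ofReal_pow]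

/-- The vector representing a linear functional on a Euclidean space. -/
lemma exists_dotProduct_eq (l : EuclideanSpace 𝕜 (Fin d) →ₗ[𝕜] 𝕜) {M : ℝ} (hM : 0 ≤ M)
    (hl : ∀ c, ‖l c‖ ≤ M * ‖c‖) :
    ∃ v : Fin d → 𝕜, ‖WithLp.toLp 2 v‖ ≤ M ∧ ∀ c : Fin d → 𝕜, l (WithLp.toLp 2 c) = star v ⬝ᵥ c := by
  set v : Fin d → 𝕜 := fun i => star (l (EuclideanSpace.single i 1)) with hv
  have hrep : ∀ c : Fin d → 𝕜, l (WithLp.toLp 2 c) = star v ⬝ᵥ c := by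
    intro c
    have h1 : WithLp.toLp 2 c = ∑ i, c i • EuclideanSpace.single i (1 : 𝕜) := by
      ext j
      simp [Pi.single_apply]
    rw [h1, map_sum, dotProduct]
    refine Finset.sum_congr rfl fun i _ => ?_
    rw [map_smul, smul_eq_mul, mul_comm, Pi.star_apply, hv, star_star]
  refine ⟨v, ?_, hrep⟩
  -- Testing the functional on its own representing vector gives the norm bound.
  have h2 := hl (WithLp.toLp 2 v)
  rw [hrep, star_dotProduct_self, RCLike.norm_ofReal, abs_of_nonneg (by positivity)] at h2
  by_contra hcon
  push Not at hcon
  nlinarith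

/-- Halving of sums of squares: the error is of order `√(p M² n)`, where `p` is logarithmic in the
dimension. -/
theorem exists_halving_sq {ι : Type*} [Fintype ι] {p : ℕ}
    (ev : ι → Bool → EuclideanSpace 𝕜 (Fin d) →ₗ[𝕜] 𝕜) {M n : ℝ} (hM : 0 ≤ M) (hn : 0 ≤ n)
    (hev : ∀ j b c, ‖ev j b c‖ ≤ M * ‖c‖) (hp : p ≠ 0) (hd : (d : ℝ) ≤ 4 ^ p)
    (hsum : ∀ c, ‖c‖ ≤ 1 → ∑ j, (‖ev j true c‖ ^ 2 + ‖ev j false c‖ ^ 2) ≤ 2 * n) :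
    ∃ σ : ι → Bool, ∀ c, ‖c‖ ≤ 1 →
      |∑ j, boolSign (σ j) * (‖ev j true c‖ ^ 2 - ‖ev j false c‖ ^ 2)| ≤
        Real.sqrt (32 * p * M ^ 2 * n) := by
  classical
  choose V hVM hV using fun j b => exists_dotProduct_eq (ev j b) hM (hev j b)
  -- The quadratic form of `A j` is the difference of squared evaluations in pair `j`, so uniformity
  -- over the ball becomes an operator norm bound.
  set A : ι → Matrix (Fin d) (Fin d) 𝕜 := fun j =>
    vecMulVec (V j true) (star (V j true)) - vecMulVec (V j false) (star (V j false)) with hAdef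
  have hA : ∀ j, (A j).IsHermitian := by
    intro j
    simp only [hAdef, Matrix.IsHermitian, conjTranspose_sub, conjTranspose_vecMulVec, star_star]
  have hAx : ∀ j (x : Fin d → 𝕜), A j *ᵥ x =
      ev j true (WithLp.toLp 2 x) • V j true - ev j false (WithLp.toLp 2 x) • V j false := by
    intro j x
    simp only [hAdef, sub_mulVec, vecMulVec_mulVec, hV, op_smul_eq_smul]
  have hquad : ∀ j (x : Fin d → 𝕜), star x ⬝ᵥ (A j *ᵥ x) =
      ((‖ev j true (WithLp.toLp 2 x)‖ ^ 2 - ‖ev j false (WithLp.toLp 2 x)‖ ^ 2 : ℝ) : 𝕜) := by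
    intro j x
    have h1 : ∀ b, star x ⬝ᵥ (ev j b (WithLp.toLp 2 x) • V j b) =
        ((‖ev j b (WithLp.toLp 2 x)‖ ^ 2 : ℝ) : 𝕜) := by
      intro b
      have h2 : star x ⬝ᵥ V j b = star (ev j b (WithLp.toLp 2 x)) := by
        rw [hV, star_dotProduct]
      rw [dotProduct_smul, h2, smul_eq_mul, RCLike.star_def, RCLike.mul_conj, RCLike.ofReal_pow]
    rw [hAx, dotProduct_sub, h1, h1, RCLike.ofReal_sub]
  have hsum' : ∀ c, ∑ j, (‖ev j true c‖ ^ 2 + ‖ev j false c‖ ^ 2) ≤ 2 * n * ‖c‖ ^ 2 := by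
    intro c
    rcases eq_or_ne c 0 with rfl | hc
    · simp
    have hc0 : 0 < ‖c‖ := norm_pos_iff.2 hc
    have h1 := hsum (((‖c‖⁻¹ : ℝ) : 𝕜) • c) (by
      rw [norm_smul, RCLike.norm_ofReal, abs_of_nonneg (by positivity), inv_mul_cancel₀ hc0.ne'])
    simp only [map_smul, norm_smul, RCLike.norm_ofReal, mul_pow, sq_abs, ← mul_add,
      ← Finset.mul_sum] at h1
    rw [inv_pow, inv_mul_le_iff₀ (by positivity)] at h1
    linarith
  have hAA : ∀ j (x : Fin d → 𝕜), star x ⬝ᵥ ((A j * A j) *ᵥ x) =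
      ((‖WithLp.toLp 2 (A j *ᵥ x)‖ ^ 2 : ℝ) : 𝕜) := by
    intro j x
    rw [← star_dotProduct_self, ← mulVec_mulVec, dotProduct_mulVec, star_mulVec, (hA j).eq]
  have hAnorm : ∀ j (x : Fin d → 𝕜), ‖WithLp.toLp 2 (A j *ᵥ x)‖ ^ 2 ≤ 2 * M ^ 2 *
      (‖ev j true (WithLp.toLp 2 x)‖ ^ 2 + ‖ev j false (WithLp.toLp 2 x)‖ ^ 2) := by
    intro j x
    have h1 : ‖WithLp.toLp 2 (A j *ᵥ x)‖ ≤
        M * (‖ev j true (WithLp.toLp 2 x)‖ + ‖ev j false (WithLp.toLp 2 x)‖) := by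
      rw [hAx, WithLp.toLp_sub, WithLp.toLp_smul, WithLp.toLp_smul]
      refine (norm_sub_le _ _).trans ?_
      rw [norm_smul, norm_smul]
      nlinarith [mul_le_mul_of_nonneg_left (hVM j true) (norm_nonneg (ev j true (WithLp.toLp 2 x))),
        mul_le_mul_of_nonneg_left (hVM j false) (norm_nonneg (ev j false (WithLp.toLp 2 x)))]
    have h2 := pow_le_pow_left₀ (norm_nonneg _) h1 2
    refine h2.trans ?_
    rw [mul_pow]
    have h3 := sq_nonneg (‖ev j true (WithLp.toLp 2 x)‖ - ‖ev j false (WithLp.toLp 2 x)‖)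
    have h4 : (‖ev j true (WithLp.toLp 2 x)‖ + ‖ev j false (WithLp.toLp 2 x)‖) ^ 2 ≤
        2 * (‖ev j true (WithLp.toLp 2 x)‖ ^ 2 + ‖ev j false (WithLp.toLp 2 x)‖ ^ 2) := by
      linarith
    have := mul_le_mul_of_nonneg_left h4 (sq_nonneg M)
    linarith
  -- The matrix variance: `‖A j x‖²` is at most `2 M²` times the squared evaluations of the pair,
  -- and these sum to at most `2 n ‖x‖²`.
  have hPSD : ((4 * M ^ 2 * n) • (1 : Matrix (Fin d) (Fin d) 𝕜) - ∑ j, A j * A j).PosSemidef := by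
    refine PosSemidef.of_dotProduct_mulVec_nonneg ?_ fun x => ?_
    · have h1 : ∀ j, (A j * A j)ᴴ = A j * A j := fun j => by
        rw [conjTranspose_mul, (hA j).eq]
      simp only [Matrix.IsHermitian, conjTranspose_sub, conjTranspose_smul, conjTranspose_one,
        conjTranspose_sum, h1, star_trivial]
    · have h1 : star x ⬝ᵥ (((4 * M ^ 2 * n) • (1 : Matrix (Fin d) (Fin d) 𝕜) -
          ∑ j, A j * A j) *ᵥ x) = ((4 * M ^ 2 * n * ‖WithLp.toLp 2 x‖ ^ 2 -
            ∑ j, ‖WithLp.toLp 2 (A j *ᵥ x)‖ ^ 2 : ℝ) : 𝕜) := by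
        rw [sub_mulVec, dotProduct_sub, sum_mulVec, dotProduct_sum, smul_mulVec, one_mulVec,
          dotProduct_smul, star_dotProduct_self, RCLike.ofReal_sub, RCLike.ofReal_sum,
          RCLike.real_smul_eq_coe_mul, ← RCLike.ofReal_mul]
        congr 1
        exact Finset.sum_congr rfl fun j _ => hAA j x
      rw [h1, RCLike.ofReal_nonneg, sub_nonneg]
      refine (Finset.sum_le_sum fun j _ => hAnorm j x).trans ?_
      rw [← Finset.mul_sum]
      have := mul_le_mul_of_nonneg_left (hsum' (WithLp.toLp 2 x))
        (by positivity : 0 ≤ 2 * M ^ 2)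
      linarith
  have hmom := sum_re_trace_signedSum_pow_le_pow hA (by positivity) hPSD p
  obtain ⟨σ, -, hσ⟩ : ∃ σ ∈ (Finset.univ : Finset (ι → Bool)),
      RCLike.re (trace (signedSum A σ ^ (2 * p))) ≤ (2 * p * (4 * M ^ 2 * n)) ^ p * d := by
    refine Finset.exists_le_of_sum_le Finset.univ_nonempty (hmom.trans (le_of_eq ?_))
    simp only [Finset.sum_const, Finset.card_univ, Fintype.card_fun, Fintype.card_bool,
      Fintype.card_fin, nsmul_eq_mul]
    push_cast
    ring
  refine ⟨σ, fun c hc => ?_⟩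
  -- The dimension factor of the trace is absorbed by `4 ^ p`, turning the constant 8 into 32.
  have hB : RCLike.re (trace (signedSum A σ ^ (2 * p))) ≤
      Real.sqrt (32 * p * M ^ 2 * n) ^ (2 * p) := by
    rw [pow_mul (Real.sqrt _), Real.sq_sqrt (by positivity)]
    refine hσ.trans ?_
    calc (2 * p * (4 * M ^ 2 * n)) ^ p * d ≤ (2 * p * (4 * M ^ 2 * n)) ^ p * 4 ^ p := by gcongr
      _ = _ := by rw [← mul_pow]; congr 1; ring
  have hfin := abs_re_dotProduct_mulVec_le (signedSum_isHermitian hA σ) hp (Real.sqrt_nonneg _) hB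
    c.ofLp
  have h1 : RCLike.re (star c.ofLp ⬝ᵥ signedSum A σ *ᵥ c.ofLp) =
      ∑ j, boolSign (σ j) * (‖ev j true c‖ ^ 2 - ‖ev j false c‖ ^ 2) := by
    unfold signedSum
    rw [sum_mulVec, dotProduct_sum, map_sum]
    refine Finset.sum_congr rfl fun j _ => ?_
    rw [smul_mulVec, dotProduct_smul, RCLike.smul_re, hquad, RCLike.ofReal_re]
  rw [h1, ← EuclideanSpace.norm_sq_eq] at hfin
  refine hfin.trans (mul_le_of_le_one_right (Real.sqrt_nonneg _) ?_)
  exact pow_le_one₀ (norm_nonneg _) hc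

lemma one_le_log_of_eight_le {x : ℝ} (hx : 8 ≤ x) : 1 ≤ Real.log x := by
  rw [Real.le_log_iff_exp_le (by linarith)]
  have := Real.exp_one_lt_d9
  linarith

/-- A net for evaluation functionals whose size does not depend on their number. -/
lemma exists_net_of_dimension {J : Type*} (ev : J → EuclideanSpace 𝕜 (Fin d) →ₗ[𝕜] 𝕜) {M s : ℝ}
    (hM : 0 < M) (hev : ∀ j y, ‖ev j y‖ ≤ M * ‖y‖) (hs : 0 < s) (hsM : s ≤ M)
    {K : Set (EuclideanSpace 𝕜 (Fin d))} (hK : ∀ c ∈ K, ‖c‖ ≤ 1) :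
    ∃ T : Finset (EuclideanSpace 𝕜 (Fin d)), ↑T ⊆ K ∧
      (T.card : ℝ) ≤ Real.exp (24 * M ^ 2 * ((d + 1) * Real.log (8 * (d + 1))) / s ^ 2) ∧
      ∀ c ∈ K, ∃ g ∈ T, ∀ j, ‖ev j (c - g)‖ ≤ s := by
  set R := Real.sqrt (d + 1 : ℝ) with hR
  have hR2 : R ^ 2 = d + 1 := Real.sq_sqrt (by positivity)
  have hR1 : 1 ≤ R := by
    rw [hR, Real.one_le_sqrt]
    have : (0 : ℝ) ≤ d := Nat.cast_nonneg d
    linarith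
  have hs' : s / (M * R) ≤ 1 := by
    rw [div_le_one (by positivity)]
    nlinarith
  -- The coordinate functionals, with the zero functional added so that the index type is nonempty
  -- even for `d = 0`.
  let l : Option (Fin d) → EuclideanSpace 𝕜 (Fin d) →ₗ[𝕜] 𝕜 := fun i =>
    i.elim 0 fun i => (EuclideanSpace.proj i : EuclideanSpace 𝕜 (Fin d) →L[𝕜] 𝕜).toLinearMap
  have hl : ∀ i y, ‖l i y‖ ≤ 1 * ‖y‖ := by
    rintro (_ | i) y
    · simp [l]
    · simpa [l] using PiLp.norm_apply_le y i
  obtain ⟨T, hTK, hcard, hnet⟩ := exists_net l one_pos hl (by positivity) hs' hK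
  refine ⟨T, hTK, hcard.trans (le_of_eq ?_), fun c hc => ?_⟩
  · rw [Fintype.card_option, Fintype.card_fin]
    congr 1
    push_cast
    rw [div_pow, mul_pow, hR2]
    field_simp
  · obtain ⟨g, hg, h⟩ := hnet c hc
    refine ⟨g, hg, fun j => (hev j _).trans ?_⟩
    have h1 : ‖c - g‖ ^ 2 ≤ (s / M) ^ 2 := by
      rw [EuclideanSpace.norm_sq_eq]
      calc ∑ i, ‖(c - g).ofLp i‖ ^ 2 ≤ ∑ _i : Fin d, (s / (M * R)) ^ 2 := by
            gcongr with i
            simpa [l] using h (some i)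
        _ = d * (s / M) ^ 2 / R ^ 2 := by
            rw [Finset.sum_const, Finset.card_univ, Fintype.card_fin, nsmul_eq_mul]
            field_simp
        _ ≤ (s / M) ^ 2 := by
            rw [div_le_iff₀ (by positivity), hR2, mul_comm]
            gcongr
            linarith
    have h2 := (le_abs_self _).trans (abs_le_of_sq_le_sq h1 (by positivity))
    calc M * ‖c - g‖ ≤ M * (s / M) := by gcongr
      _ = s := by field_simp

/-- Halving of sums of `q`-th powers, `q > 2`. -/
theorem exists_halving_rpow {q : ℝ} (hq : 2 < q) {ι : Type*} [Fintype ι] [Nonempty ι]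
    (ev : ι → Bool → EuclideanSpace 𝕜 (Fin d) →ₗ[𝕜] 𝕜) {M n x : ℝ} (hM : 0 < M)
    (hev : ∀ j b c, ‖ev j b c‖ ≤ M * ‖c‖) {K : Set (EuclideanSpace 𝕜 (Fin d))}
    (hK : ∀ c ∈ K, ‖c‖ ≤ 1) (hn : 2 * (Fintype.card ι : ℝ) = n) (hx0 : 0 < x) (hx1 : x ≤ 1)
    (hx : 24 * M ^ q * Real.log (8 * n) ≤ n * x ^ 4 ∨
      24 * M ^ q * ((d + 1) * Real.log (8 * (d + 1))) ≤ n * x ^ 4)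
    (hsum : ∀ c ∈ K, ∑ j, (‖ev j true c‖ ^ q + ‖ev j false c‖ ^ q) ≤ 2 * n) :
    ∃ σ : ι → Bool, ∀ c ∈ K,
      |∑ j, boolSign (σ j) * (‖ev j true c‖ ^ q - ‖ev j false c‖ ^ q)| ≤
        halvingConst q * n * x := by
  have hcard : (1 : ℝ) ≤ Fintype.card ι := by exact_mod_cast Fintype.card_pos (α := ι)
  have hd0 : (0 : ℝ) ≤ d := Nat.cast_nonneg d
  -- The largest entropy constant compatible with error level `x`; either alternative in `hx`
  -- supplies nets within it.
  set A := n * x ^ 4 / M ^ (q - 2) with hA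
  have hMq : 0 < M ^ (q - 2) := Real.rpow_pos_of_pos hM _
  have hMsplit : M ^ q = M ^ 2 * M ^ (q - 2) := by
    rw [← Real.rpow_two, ← Real.rpow_add hM]; congr 1; ring
  have hA' : 24 * M ^ 2 * Real.log (8 * n) ≤ A ∨
      24 * M ^ 2 * ((d + 1) * Real.log (8 * (d + 1))) ≤ A := by
    rw [hA, le_div_iff₀ hMq, le_div_iff₀ hMq]
    refine hx.imp (fun h => ?_) (fun h => ?_) <;>
    · rw [hMsplit] at h
      linarith
  have hlog1 : 1 ≤ Real.log (8 * n) := one_le_log_of_eight_le (by linarith)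
  have hlog2 : 1 ≤ Real.log (8 * (d + 1)) := one_le_log_of_eight_le (by linarith)
  have hAM : 3 * M ^ 2 ≤ A := by
    have hM2 : 0 < M ^ 2 := by positivity
    rcases hA' with h | h
    · nlinarith
    · have : 1 ≤ (d + 1) * Real.log (8 * (d + 1)) := by nlinarith
      nlinarith
  refine exists_halving_of_entropy hq K (fun c j b => ‖ev j b c‖) hM hn hAM hx0 hx1
    (by rw [hA]; field_simp) (fun c _ j b => norm_nonneg _)
    (fun c hc j b => (hev j b c).trans (mul_le_of_le_one_right hM.le (hK c hc))) hsum ?_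
  intro s hs hsM
  have hdist : ∀ j b (c g : EuclideanSpace 𝕜 (Fin d)),
      |‖ev j b c‖ - ‖ev j b g‖| ≤ ‖ev j b (c - g)‖ := fun j b c g => by
    rw [map_sub]; exact abs_norm_sub_norm_le _ _
  rcases hA' with h | h
  · obtain ⟨T, hTK, hT, hnet⟩ := exists_net (fun jb : ι × Bool => ev jb.1 jb.2) hM
      (fun jb y => hev _ _ _) hs hsM hK
    refine ⟨T, hTK, hT.trans ?_, fun c hc => ?_⟩
    · rw [Fintype.card_prod, Fintype.card_bool]
      push_cast
      rw [mul_comm (Fintype.card ι : ℝ) 2, hn]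
      gcongr
    · obtain ⟨g, hg, hcg⟩ := hnet c hc
      exact ⟨g, hg, fun j b => (hdist j b c g).trans (hcg (j, b))⟩
  · obtain ⟨T, hTK, hT, hnet⟩ := exists_net_of_dimension (fun jb : ι × Bool => ev jb.1 jb.2) hM
      (fun jb y => hev _ _ _) hs hsM hK
    refine ⟨T, hTK, hT.trans ?_, fun c hc => ?_⟩
    · gcongr
    · obtain ⟨g, hg, hcg⟩ := hnet c hc
      exact ⟨g, hg, fun j b => (hdist j b c g).trans (hcg (j, b))⟩

end Halving

/-! ### Iterated halving. -/

/-- Repeated halving: from `2 ^ k * m` points to `m` points. -/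
lemma exists_thinning {α P : Type*} (K : Set α) (F : α → P → ℝ) (Q : α → ℝ)
    (hQ : ∀ c ∈ K, Q c ≤ 1) {m : ℕ} (e : ℕ → ℝ) (he : ∀ i, 0 ≤ e i)
    (hhalf : ∀ i : ℕ, ∀ z : Fin (2 ^ i * m) → Bool → P,
      (∀ c ∈ K, ∑ j, (F c (z j true) + F c (z j false)) ≤ 2 * (2 * (2 ^ i * m))) →
      ∃ σ : Fin (2 ^ i * m) → Bool, ∀ c ∈ K,
        |∑ j, boolSign (σ j) * (F c (z j true) - F c (z j false))| ≤ 2 * (2 ^ i * m) * e i)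
    (k : ℕ) : ∀ η : ℝ, η + ∑ i ∈ Finset.range k, e i ≤ 1 →
      ∀ z : Fin (2 ^ k * m) → P,
        (∀ c ∈ K, |∑ j, F c (z j) - (2 ^ k * m) * Q c| ≤ (2 ^ k * m) * η) →
        ∃ w : Fin m → P, ∀ c ∈ K,
          |∑ j, F c (w j) - m * Q c| ≤ m * (η + ∑ i ∈ Finset.range k, e i) := by
  induction k with
  | zero =>
    intro η _ z hz
    refine ⟨fun j => z (Fin.cast (by simp) j), fun c hc => ?_⟩
    have h := hz c hc
    have h1 : ∑ j : Fin m, F c (z (Fin.cast (by simp) j)) = ∑ j, F c (z j) :=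
      Equiv.sum_comp (finCongr (by simp)) fun j => F c (z j)
    rw [h1]
    simpa using h
  | succ k ih =>
    intro η hη z hz
    have hη1 : η ≤ 1 := by
      have := Finset.sum_nonneg fun i (_ : i ∈ Finset.range (k + 1)) => he i
      linarith
    let φ : Fin (2 ^ k * m) × Bool ≃ Fin (2 ^ (k + 1) * m) := Fintype.equivOfCardEq (by
      simp only [Fintype.card_prod, Fintype.card_fin, Fintype.card_bool]; ring)
    have hp0 : (0 : ℝ) ≤ 2 ^ k * m := by positivity
    have htot : ∀ c, ∑ j, F c (z j) =
        ∑ j, (F c (z (φ (j, true))) + F c (z (φ (j, false)))) := by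
      intro c
      rw [← Equiv.sum_comp φ, Fintype.sum_prod_type]
      exact Finset.sum_congr rfl fun j _ => Fintype.sum_bool _
    have hpow : ((2 : ℝ) ^ (k + 1) * m) = 2 * (2 ^ k * m) := by ring
    -- The sum over the `n` current points is at most `n (Q c + η) ≤ 2 n`, which is why the
    -- accumulated error must stay below one.
    obtain ⟨σ, hσ⟩ := hhalf k (fun j b => z (φ (j, b))) (fun c hc => by
      rw [← htot]
      have h1 := (abs_le.1 (hz c hc)).2
      rw [hpow] at h1
      nlinarith [hQ c hc])
    refine (ih (η + e k) ?_ (fun j => z (φ (j, σ j))) fun c hc => ?_).imp fun w hw c hc => ?_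
    · rw [Finset.sum_range_succ] at hη; linarith
    · have h1 := hσ c hc
      have h2 := hz c hc
      rw [htot, hpow] at h2
      -- The sum over the survivors is half of the full sum plus the signed sum.
      have h3 : ∑ j, F c (z (φ (j, σ j))) =
          1 / 2 * (∑ j, (F c (z (φ (j, true))) + F c (z (φ (j, false)))) +
            ∑ j, boolSign (σ j) * (F c (z (φ (j, true))) - F c (z (φ (j, false))))) := by
        rw [← Finset.sum_add_distrib, Finset.mul_sum]
        refine Finset.sum_congr rfl fun j _ => ?_
        cases σ j <;> simp <;> ring
      rw [h3]
      rw [abs_le] at h1 h2 ⊢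
      constructor <;> linarith [h1.1, h1.2, h2.1, h2.2]
    · have := hw c hc
      rw [Finset.sum_range_succ]
      refine this.trans (le_of_eq ?_)
      ring

/-- Discretization from asymptotic discretization and geometrically decaying halving errors. -/
lemma exists_points_of_halving {α P : Type*} (K : Set α) (F : α → P → ℝ) (Q : α → ℝ)
    (hQ : ∀ c ∈ K, Q c ≤ 1) {ε e₀ : ℝ} (hε : 0 < ε) (hε1 : ε ≤ 1) (he₀ : 0 ≤ e₀)
    (he : 40 * e₀ ≤ ε) {m : ℕ} (hm : 0 < m)
    (hinit : ∀ η : ℝ, 0 < η → ∃ n₀ : ℕ, ∀ n ≥ n₀, ∃ z : Fin n → P,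
      ∀ c ∈ K, |∑ j, F c (z j) - n * Q c| ≤ n * η)
    (hhalf : ∀ i : ℕ, ∀ z : Fin (2 ^ i * m) → Bool → P,
      (∀ c ∈ K, ∑ j, (F c (z j true) + F c (z j false)) ≤ 2 * (2 * (2 ^ i * m))) →
      ∃ σ : Fin (2 ^ i * m) → Bool, ∀ c ∈ K,
        |∑ j, boolSign (σ j) * (F c (z j true) - F c (z j false))| ≤
          2 * (2 ^ i * m) * (e₀ * (19 / 20) ^ i)) :
    ∃ w : Fin m → P, ∀ c ∈ K, |∑ j, F c (w j) - m * Q c| ≤ m * ε := by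
  obtain ⟨n₀, hn₀⟩ := hinit (ε / 2) (half_pos hε)
  have hk : n₀ ≤ 2 ^ n₀ * m :=
    (Nat.lt_two_pow_self (n := n₀)).le.trans (Nat.le_mul_of_pos_right _ hm)
  obtain ⟨z, hz⟩ := hn₀ _ hk
  -- The series sums to at most `20 * e₀`; the other `ε / 2` is spent on the initial sample.
  have hsum : ∑ i ∈ Finset.range n₀, e₀ * (19 / 20 : ℝ) ^ i ≤ ε / 2 := by
    rw [← Finset.mul_sum]
    have h1 := sum_geometric_le (by norm_num : (0 : ℝ) ≤ 19 / 20) (by norm_num) n₀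
    have h2 := mul_le_mul_of_nonneg_left h1 he₀
    norm_num at h2 ⊢
    linarith
  obtain ⟨w, hw⟩ := exists_thinning K F Q hQ (fun i => e₀ * (19 / 20) ^ i)
    (fun i => by positivity) hhalf n₀ (ε / 2) (by linarith) z (fun c hc => by
      have := hz c hc
      push_cast at this
      exact this)
  refine ⟨w, fun c hc => (hw c hc).trans ?_⟩
  gcongr
  linarith

/-! ### How many points suffice. -/

section Thresholds

variable {𝕜 : Type*} [RCLike 𝕜] {d : ℕ}

/-- Discretization of the Euclidean norm by points with bounded evaluation functionals. -/
lemma exists_points_sq {P : Type*} (ev : P → EuclideanSpace 𝕜 (Fin d) →ₗ[𝕜] 𝕜) {M ε : ℝ}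
    (hM : 0 < M) (hev : ∀ x c, ‖ev x c‖ ≤ M * ‖c‖) (hε : 0 < ε) (hε1 : ε ≤ 1)
    {Q : EuclideanSpace 𝕜 (Fin d) → ℝ} (hQ : ∀ c, Q c = ‖c‖ ^ 2)
    (hinit : ∀ η : ℝ, 0 < η → ∃ n₀ : ℕ, ∀ n ≥ n₀, ∃ z : Fin n → P,
      ∀ c, ‖c‖ ≤ 1 → |∑ j, ‖ev (z j) c‖ ^ (2 : ℝ) - n * Q c| ≤ n * η)
    {p m : ℕ} (hp : p ≠ 0) (hd : (d : ℝ) ≤ 4 ^ p) (hm : 0 < m)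
    (hpm : 25600 * p * M ^ 2 ≤ ε ^ 2 * m) :
    ∃ w : Fin m → P, ∀ c, ‖c‖ ≤ 1 → |∑ j, ‖ev (w j) c‖ ^ (2 : ℝ) - m * Q c| ≤ m * ε := by
  simp only [Real.rpow_two] at hinit ⊢
  have hm' : (0 : ℝ) < m := Nat.cast_pos.2 hm
  refine exists_points_of_halving {c | ‖c‖ ≤ 1} (fun c x => ‖ev x c‖ ^ 2) Q
    (fun c hc => by rw [hQ]; exact pow_le_one₀ (norm_nonneg _) hc) hε hε1
    (e₀ := ε / 40) (by positivity) (by linarith) hm hinit ?_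
  intro i z hz
  have hn : (0 : ℝ) < 2 * (2 ^ i * m) := by positivity
  obtain ⟨σ, hσ⟩ := exists_halving_sq (fun j b => ev (z j b)) hM.le hn.le
    (fun j b c => hev _ c) hp hd hz
  refine ⟨σ, fun c hc => (hσ c hc).trans ?_⟩
  refine Real.sqrt_le_iff.2 ⟨by positivity, ?_⟩
  -- The relative error of a halving behaves like `n ^ (-1 / 2)`, so it decays faster than the
  -- allowed ratio `19 / 20`.
  have h1 : (1 / 2 : ℝ) ^ i ≤ ((19 / 20) ^ i) ^ 2 := by
    rw [← pow_mul, mul_comm, pow_mul]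
    exact pow_le_pow_left₀ (by norm_num) (by norm_num) i
  have h2 : (1 / 2 : ℝ) ^ i * 2 ^ i = 1 := by rw [← mul_pow]; norm_num
  have h3 : 1 ≤ ((19 / 20 : ℝ) ^ i) ^ 2 * 2 ^ i := by
    rw [← h2]; gcongr
  calc 32 * p * M ^ 2 * (2 * (2 ^ i * m)) = (25600 * p * M ^ 2) * (m * 2 ^ i / 400) := by ring
    _ ≤ (ε ^ 2 * m) * (m * 2 ^ i / 400) := by gcongr
    _ = (ε ^ 2 * m ^ 2 * 2 ^ i / 400) * 1 := by ring
    _ ≤ (ε ^ 2 * m ^ 2 * 2 ^ i / 400) * (((19 / 20 : ℝ) ^ i) ^ 2 * 2 ^ i) := by gcongr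
    _ = (2 * (2 ^ i * m) * (ε / 40 * (19 / 20) ^ i)) ^ 2 := by ring

/-- The scale at which halving errors of exponent `q` sum up to `ε / 2`. -/
noncomputable def halvingScale (q ε : ℝ) : ℝ := ε / (40 * halvingConst q)

lemma halvingScale_pos {q ε : ℝ} (hq : 2 < q) (hε : 0 < ε) : 0 < halvingScale q ε :=
  div_pos hε (mul_pos (by norm_num) (halvingConst_pos hq))

lemma one_le_halvingConst {q : ℝ} (hq : 2 < q) : 1 ≤ halvingConst q := by
  have h1 := levelRatio_lt_one hq
  have h2 : (0 : ℝ) < 2 ^ q := Real.rpow_pos_of_pos two_pos _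
  have h3 : 0 < 1 - levelRatio q := by linarith
  unfold halvingConst
  have : 0 ≤ (4 * (q * 2 ^ q) + 3) / (1 - levelRatio q) := by positivity
  linarith

/-- Discretization of `q`-th powers, `q > 2`, by points with bounded evaluation functionals. -/
lemma exists_points_rpow {q : ℝ} (hq : 2 < q) {P : Type*}
    (ev : P → EuclideanSpace 𝕜 (Fin d) →ₗ[𝕜] 𝕜) {M ε : ℝ}
    (hM : 0 < M) (hev : ∀ x c, ‖ev x c‖ ≤ M * ‖c‖) (hε : 0 < ε) (hε1 : ε ≤ 1)
    {Q : EuclideanSpace 𝕜 (Fin d) → ℝ} (hQ : ∀ c, ‖c‖ ^ q ≤ Q c)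
    (hinit : ∀ η : ℝ, 0 < η → ∃ n₀ : ℕ, ∀ n ≥ n₀, ∃ z : Fin n → P,
      ∀ c, ‖c‖ ≤ 1 → |∑ j, ‖ev (z j) c‖ ^ q - n * Q c| ≤ n * η)
    {m : ℕ} (hm : 0 < m)
    (hmM : 24 * M ^ q * Real.log (16 * m) ≤ m * halvingScale q ε ^ 4 ∨
      24 * M ^ q * ((d + 1) * Real.log (8 * (d + 1))) ≤ m * halvingScale q ε ^ 4) :
    ∃ w : Fin m → P, ∀ c, Q c ≤ 1 → |∑ j, ‖ev (w j) c‖ ^ q - m * Q c| ≤ m * ε := by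
  set lam := halvingScale q ε with hlam
  have hlam0 : 0 < lam := halvingScale_pos hq hε
  have hC1 := one_le_halvingConst hq
  have hlamC : 40 * (halvingConst q * lam) = ε := by
    rw [hlam, halvingScale]; field_simp
  have hlam1 : lam ≤ 1 := by nlinarith
  have hm1 : (1 : ℝ) ≤ m := by exact_mod_cast hm
  have hMq : 0 < M ^ q := Real.rpow_pos_of_pos hM _
  have hball : ∀ c, Q c ≤ 1 → ‖c‖ ≤ 1 := by
    intro c hc
    by_contra hcon
    push Not at hcon
    have := Real.one_lt_rpow hcon (by linarith : 0 < q)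
    linarith [hQ c]
  refine exists_points_of_halving {c | Q c ≤ 1} (fun c x => ‖ev x c‖ ^ q) Q
    (fun c hc => hc) hε hε1 (e₀ := halvingConst q * lam) (by positivity) hlamC.le hm
    (fun η hη => (hinit η hη).imp fun n₀ h n hn => (h n hn).imp fun z hz c hc =>
      hz c (hball c hc)) ?_
  intro i z hz
  have : Nonempty (Fin (2 ^ i * m)) := ⟨⟨0, by positivity⟩⟩
  -- The ratio `19 / 20` satisfies `2 * (19 / 20) ^ 4 ≥ 3 / 2`, so `n * x ^ 4` outgrows the linear
  -- increase in `i` of `log n`.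
  have hgrow : (1 : ℝ) + i ≤ 2 * 2 ^ i * ((19 / 20) ^ i) ^ 4 := by
    have h1 := one_add_mul_le_pow (by norm_num : (-2 : ℝ) ≤ 1 / 2) i
    have h2 : (1 + 1 / 2 : ℝ) ^ i ≤ (2 * (19 / 20) ^ 4) ^ i :=
      pow_le_pow_left₀ (by norm_num) (by norm_num) i
    have h3 : (2 * (19 / 20 : ℝ) ^ 4) ^ i = 2 ^ i * ((19 / 20) ^ i) ^ 4 := by
      rw [mul_pow, ← pow_mul, ← pow_mul, mul_comm 4]
    have h4 : (0 : ℝ) ≤ i := Nat.cast_nonneg i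
    rw [h3] at h2
    linarith
  have hi0 : (0 : ℝ) ≤ i := Nat.cast_nonneg i
  have hx : 24 * M ^ q * Real.log (8 * (2 * (2 ^ i * m))) ≤
        2 * (2 ^ i * m) * (lam * (19 / 20) ^ i) ^ 4 ∨
      24 * M ^ q * ((d + 1) * Real.log (8 * (d + 1))) ≤
        2 * (2 ^ i * m) * (lam * (19 / 20) ^ i) ^ 4 := by
    refine hmM.imp (fun h => ?_) (fun h => ?_)
    · have hL1 : 1 ≤ Real.log (16 * m) := one_le_log_of_eight_le (by linarith)
      have hlog : Real.log (8 * (2 * (2 ^ i * m))) ≤ Real.log (16 * m) * (1 + i) := by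
        rw [show (8 : ℝ) * (2 * (2 ^ i * m)) = 16 * m * 2 ^ i by ring,
          Real.log_mul (by positivity) (by positivity), Real.log_pow]
        have := Real.log_two_lt_d9
        nlinarith
      calc 24 * M ^ q * Real.log (8 * (2 * (2 ^ i * m)))
          ≤ 24 * M ^ q * (Real.log (16 * m) * (1 + i)) := by gcongr
        _ = 24 * M ^ q * Real.log (16 * m) * (1 + i) := by ring
        _ ≤ m * lam ^ 4 * (2 * 2 ^ i * ((19 / 20) ^ i) ^ 4) := by gcongr
        _ = _ := by ring
    · calc 24 * M ^ q * ((d + 1) * Real.log (8 * (d + 1)))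
          ≤ m * lam ^ 4 := h
        _ ≤ m * lam ^ 4 * (2 * 2 ^ i * ((19 / 20) ^ i) ^ 4) :=
            le_mul_of_one_le_right (by positivity) (by linarith)
        _ = _ := by ring
  obtain ⟨σ, hσ⟩ := exists_halving_rpow hq (fun j b => ev (z j b)) (n := 2 * (2 ^ i * m))
    (x := lam * (19 / 20) ^ i) hM (fun j b c => hev _ c) (K := {c | Q c ≤ 1})
    (fun c hc => hball c hc) (by rw [Fintype.card_fin]; push_cast; ring) (by positivity)
    (mul_le_one₀ hlam1 (by positivity) (pow_le_one₀ (by norm_num) (by norm_num))) hx hz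
  refine ⟨σ, fun c hc => (hσ c hc).trans (le_of_eq ?_)⟩
  ring

/-- The exponent is at least one; the factor `1 / 2` covers `N = 2`, where `log N < 1`. -/
lemma half_log_le_log_rpow {q : ℝ} (hq : 2 ≤ q) {N : ℕ} (hN : 2 ≤ N) :
    Real.log N / 2 ≤ Real.log N ^ (2 - 2 / q) := by
  have hN' : (2 : ℝ) ≤ N := by exact_mod_cast hN
  have h0 : (1 / 2 : ℝ) ≤ Real.log N := by
    have h1 := Real.log_two_gt_d9
    have h2 := Real.log_le_log two_pos hN'
    linarith
  have hpos : 0 < Real.log N := by linarith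
  have hq2 : 2 / q ≤ 1 := by rw [div_le_one (by linarith)]; exact hq
  have hq0 : 0 ≤ 2 / q := by positivity
  rw [show 2 - 2 / q = 1 + (1 - 2 / q) by ring, Real.rpow_add hpos, Real.rpow_one]
  have : 1 / 2 ≤ Real.log N ^ (1 - 2 / q) := by
    rcases le_total 1 (Real.log N) with h | h
    · have := Real.one_le_rpow h (by linarith : 0 ≤ 1 - 2 / q)
      linarith
    · have := Real.rpow_le_rpow_of_exponent_ge hpos h (by linarith : 1 - 2 / q ≤ 1)
      rw [Real.rpow_one] at this
      linarith
  nlinarith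

/-- The number of points needed, in terms of `N`, for evaluation functionals bounded by `t √N`. -/
theorem exists_const_exists_points {t q ε : ℝ} (ht : 0 < t) (hq : 2 ≤ q) (hε : 0 < ε)
    (hε1 : ε ≤ 1) :
    ∃ C : ℝ, 0 < C ∧ ∀ (𝕜 : Type*) [RCLike 𝕜] (d N : ℕ), d ≤ N → 2 ≤ N →
      ∀ (P : Type*) (ev : P → EuclideanSpace 𝕜 (Fin d) →ₗ[𝕜] 𝕜)
        (Q : EuclideanSpace 𝕜 (Fin d) → ℝ),
      (∀ x c, ‖ev x c‖ ≤ t * Real.sqrt N * ‖c‖) → (∀ c, ‖c‖ ^ q ≤ Q c) →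
      (q = 2 → ∀ c, Q c = ‖c‖ ^ 2) →
      (∀ η : ℝ, 0 < η → ∃ n₀ : ℕ, ∀ n ≥ n₀, ∃ z : Fin n → P,
        ∀ c, ‖c‖ ≤ 1 → |∑ j, ‖ev (z j) c‖ ^ q - n * Q c| ≤ n * η) →
      ∀ m : ℕ, C * (N : ℝ) ^ (q / 2) * Real.log N ^ (2 - 2 / q) ≤ m →
        0 < m ∧ ∃ w : Fin m → P, ∀ c, Q c ≤ 1 →
          |∑ j, ‖ev (w j) c‖ ^ q - m * Q c| ≤ m * ε := by
  have hlogN : ∀ N : ℕ, 2 ≤ N → (0.69 : ℝ) ≤ Real.log N := fun N hN => by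
    have h1 := Real.log_two_gt_d9
    have h2 := Real.log_le_log two_pos (by exact_mod_cast hN : (2 : ℝ) ≤ N)
    linarith
  have hmpos : ∀ {C : ℝ} {N m : ℕ}, 0 < C → 2 ≤ N →
      C * (N : ℝ) ^ (q / 2) * Real.log N ^ (2 - 2 / q) ≤ m → 0 < m := by
    intro C N m hC hN h
    have hN0 : (0 : ℝ) < N := by exact_mod_cast (by omega : 0 < N)
    have h1 : 0 < Real.log N := by linarith [hlogN N hN]
    have : (0 : ℝ) < m := lt_of_lt_of_le (mul_pos (mul_pos hC (Real.rpow_pos_of_pos hN0 _))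
      (Real.rpow_pos_of_pos h1 _)) h
    exact_mod_cast this
  rcases hq.eq_or_lt with rfl | hq2
  -- `153600 = 25600 * 3 * 2`: the 3 comes from `p ≤ 3 log N`, the 2 from `half_log_le_log_rpow`.
  · refine ⟨153600 * t ^ 2 / ε ^ 2, by positivity, ?_⟩
    intro 𝕜 _ d N hdN hN P ev Q hev hQlow hQ hinit m hm
    have hm0 := hmpos (by positivity) hN hm
    refine ⟨hm0, ?_⟩
    have hN0 : (0 : ℝ) < N := by exact_mod_cast (by omega : 0 < N)
    have hL := hlogN N hN
    set p := ⌈Real.log N⌉₊ with hp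
    have hp0 : p ≠ 0 := (Nat.ceil_pos.2 (by linarith)).ne'
    have hp1 : (p : ℝ) ≤ 3 * Real.log N := by
      have := Nat.ceil_lt_add_one (by linarith : 0 ≤ Real.log N)
      rw [← hp] at this
      linarith
    have hd : (d : ℝ) ≤ 4 ^ p := by
      have h1 : (d : ℝ) ≤ N := by exact_mod_cast hdN
      have h2 : (N : ℝ) ≤ Real.exp p := by
        rw [← Real.log_le_iff_le_exp hN0]; exact Nat.le_ceil _
      have h3 : Real.exp p ≤ 4 ^ p := by
        rw [← mul_one (p : ℝ), Real.exp_nat_mul]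
        refine pow_le_pow_left₀ (Real.exp_pos _).le ?_ p
        have := Real.exp_one_lt_d9
        linarith
      linarith
    have hhalf := half_log_le_log_rpow le_rfl hN
    have hpm : 25600 * p * (t * Real.sqrt N) ^ 2 ≤ ε ^ 2 * m := by
      rw [mul_pow, Real.sq_sqrt hN0.le]
      rw [show (2 : ℝ) / 2 = 1 by norm_num, Real.rpow_one] at hm
      calc 25600 * p * (t ^ 2 * N) ≤ 25600 * (3 * Real.log N) * (t ^ 2 * N) := by gcongr
        _ = ε ^ 2 * (153600 * t ^ 2 / ε ^ 2 * N * (Real.log N / 2)) := by field_simp; ring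
        _ ≤ ε ^ 2 * (153600 * t ^ 2 / ε ^ 2 * N * Real.log N ^ (2 - (2 : ℝ) / 2)) := by gcongr
        _ ≤ ε ^ 2 * m := by
            gcongr
            simpa using hm
    obtain ⟨w, hw⟩ := exists_points_sq ev (by positivity) hev hε hε1 (hQ rfl) hinit hp0 hd hm0 hpm
    refine ⟨w, fun c hc => hw c ?_⟩
    rw [hQ rfl] at hc
    exact (sq_le_one_iff₀ (norm_nonneg c)).1 hc
  · set lam := halvingScale q ε with hlam
    have hlam0 : 0 < lam := halvingScale_pos hq2 hε
    set D := 24 * t ^ q / lam ^ 4 with hD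
    have htq : 0 < t ^ q := Real.rpow_pos_of_pos ht _
    have hD0 : 0 < D := by positivity
    set R := 2 * |Real.log (512 * D)| + (q / 2 + 2) with hR
    have hR0 : 0 < R := by positivity
    refine ⟨2 * D * R, by positivity, ?_⟩
    intro 𝕜 _ d N hdN hN P ev Q hev hQlow _ hinit m hm
    have hm0 := hmpos (by positivity) hN hm
    refine ⟨hm0, ?_⟩
    have hN0 : (0 : ℝ) < N := by exact_mod_cast (by omega : 0 < N)
    have hN2 : (2 : ℝ) ≤ N := by exact_mod_cast hN
    have hL := hlogN N hN
    have hm' : (0 : ℝ) < m := Nat.cast_pos.2 hm0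
    have hNq : 0 < (N : ℝ) ^ (q / 2) := Real.rpow_pos_of_pos hN0 _
    have hM : (t * Real.sqrt N) ^ q = t ^ q * (N : ℝ) ^ (q / 2) := by
      rw [Real.mul_rpow ht.le (Real.sqrt_nonneg _), Real.sqrt_eq_rpow, ← Real.rpow_mul hN0.le]
      congr 2
      ring
    have hDl : D * lam ^ 4 = 24 * t ^ q := by rw [hD]; field_simp
    refine exists_points_rpow hq2 ev (by positivity) hev hε hε1 hQlow hinit hm0 ?_
    rw [hM, ← hlam]
    -- For `m` above this power of `N` the wasteful factor `(d + 1) log (8 (d + 1)) ≤ 32 N²` is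
    -- affordable; below it `log (16 m)` is at most `R * log N`.
    rcases le_total (32 * D * ((N : ℝ) ^ (q / 2) * N ^ 2)) (m : ℝ) with hbig | hsmall
    · right
      have hd : (d : ℝ) + 1 ≤ 2 * N := by
        have : (d : ℝ) ≤ N := by exact_mod_cast hdN
        linarith
      have hd0 : (0 : ℝ) ≤ d := Nat.cast_nonneg d
      have hlog : Real.log (8 * (d + 1)) ≤ 16 * N := by
        have := Real.log_le_sub_one_of_pos (by positivity : (0 : ℝ) < 8 * (d + 1))
        linarith
      have hlog0 : 0 ≤ Real.log (8 * (d + 1)) := Real.log_nonneg (by linarith)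
      calc 24 * (t ^ q * (N : ℝ) ^ (q / 2)) * ((d + 1) * Real.log (8 * (d + 1)))
          ≤ 24 * (t ^ q * (N : ℝ) ^ (q / 2)) * ((2 * N) * (16 * N)) := by gcongr
        _ = (24 * t ^ q) * (32 * ((N : ℝ) ^ (q / 2) * N ^ 2)) := by ring
        _ = (32 * D * ((N : ℝ) ^ (q / 2) * N ^ 2)) * lam ^ 4 := by rw [← hDl]; ring
        _ ≤ m * lam ^ 4 := by gcongr
    · left
      have hlog : Real.log (16 * m) ≤ R * Real.log N := by
        have h1 : Real.log (16 * m) ≤ Real.log (512 * D * (N : ℝ) ^ (q / 2 + 2)) := by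
          refine Real.log_le_log (by positivity) ?_
          rw [Real.rpow_add hN0, Real.rpow_two]
          linarith
        rw [Real.log_mul (by positivity) (Real.rpow_pos_of_pos hN0 _).ne',
          Real.log_rpow hN0] at h1
        have h2 := le_abs_self (Real.log (512 * D))
        have h3 := abs_nonneg (Real.log (512 * D))
        rw [hR]
        nlinarith
      have hhalf := half_log_le_log_rpow hq2.le hN
      calc 24 * (t ^ q * (N : ℝ) ^ (q / 2)) * Real.log (16 * m)
          ≤ 24 * (t ^ q * (N : ℝ) ^ (q / 2)) * (R * Real.log N) := by gcongr
        _ = (24 * t ^ q) * (N : ℝ) ^ (q / 2) * (R * Real.log N) := by ring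
        _ = (2 * D * R * (N : ℝ) ^ (q / 2) * (Real.log N / 2)) * lam ^ 4 := by rw [← hDl]; ring
        _ ≤ (2 * D * R * (N : ℝ) ^ (q / 2) * Real.log N ^ (2 - 2 / q)) * lam ^ 4 := by gcongr
        _ ≤ m * lam ^ 4 := by gcongr

end Thresholds

/-! ### Asymptotic discretization by the law of large numbers. -/

section Sampling

open ProbabilityTheory Filter Topology

/-- Simultaneous strong law of large numbers for countably many integrable functions, along a
sequence of points with an almost sure property. -/
lemma exists_seq_tendsto_average {Ω ι : Type*} [MeasurableSpace Ω] [Countable ι] (μ : Measure Ω)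
    [IsProbabilityMeasure μ] (F : ι → Ω → ℝ) (hF : ∀ i, Integrable (F i) μ) {p : Ω → Prop}
    (hp : ∀ᵐ x ∂μ, p x) :
    ∃ ω : ℕ → Ω, (∀ k, p (ω k)) ∧ ∀ i,
      Tendsto (fun n : ℕ => (∑ k ∈ Finset.range n, F i (ω k)) / n) atTop (𝓝 (∫ x, F i x ∂μ)) := by
  set ν : Measure (ℕ → Ω) := Measure.infinitePi fun _ => μ with hν
  have hmp : ∀ k : ℕ, MeasurePreserving (Function.eval k) ν μ := fun k =>
    measurePreserving_eval_infinitePi (fun _ => μ) k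
  have hall : ∀ {s : Ω → Prop}, (∀ᵐ x ∂μ, s x) → ∀ᵐ ω ∂ν, ∀ k, s (ω k) := fun hs =>
    ae_all_iff.2 fun k => (hmp k).quasiMeasurePreserving.ae hs
  -- The strong law is applied to measurable representatives; almost every sample sequence avoids
  -- the countably many null sets where they differ from `F`.
  set G : ι → Ω → ℝ := fun i => (hF i).1.mk (F i) with hG
  have hGm : ∀ i, Measurable (G i) := fun i => (hF i).1.stronglyMeasurable_mk.measurable
  have hFG : ∀ i, F i =ᵐ[μ] G i := fun i => (hF i).1.ae_eq_mk
  have hlaw : ∀ i, ∀ᵐ ω ∂ν, Tendsto (fun n : ℕ => (∑ k ∈ Finset.range n, G i (ω k)) / n) atTop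
      (𝓝 (∫ x, F i x ∂μ)) := by
    intro i
    have hGi : Integrable (G i) μ := (hF i).congr (hFG i)
    have h := strong_law_ae_real (μ := ν) (fun k ω => G i (ω k))
      ((hmp 0).integrable_comp_of_integrable hGi)
      (fun a b hab => (iIndepFun_infinitePi (P := fun _ : ℕ => μ)
        (X := fun _ => G i) fun _ => hGm i).indepFun hab)
      (fun k => ⟨((hGm i).comp (hmp k).measurable).aemeasurable,
        ((hGm i).comp (hmp 0).measurable).aemeasurable, by
          have e : ∀ l : ℕ, ν.map (fun ω => G i (ω l)) = μ.map (G i) := fun l => by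
            rw [← (hmp l).map_eq, Measure.map_map (hGm i) (hmp l).measurable]; rfl
          rw [e, e]⟩)
    have hint : ∫ ω, G i (ω 0) ∂ν = ∫ x, F i x ∂μ := by
      rw [integral_congr_ae (hFG i), ← (hmp 0).map_eq,
        integral_map (hmp 0).measurable.aemeasurable (hGm i).aestronglyMeasurable]
    rw [hint] at h
    exact h
  obtain ⟨ω, h1, h2, h3⟩ := ((ae_all_iff.2 hlaw).and
    ((hall hp).and (ae_all_iff.2 fun i => hall (hFG i)))).exists
  refine ⟨ω, h2, fun i => (h1 i).congr fun n => ?_⟩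
  simp only [h3]

/-- Asymptotic discretization, uniform over the unit ball of a finite-dimensional space of
functions. -/
lemma exists_asymptotic_discretization {Ω 𝕜 : Type*} [RCLike 𝕜] [MeasurableSpace Ω]
    (μ : Measure Ω) [IsProbabilityMeasure μ] {d : ℕ}
    (Φ : EuclideanSpace 𝕜 (Fin d) →ₗ[𝕜] (Ω → 𝕜)) {M q : ℝ} (hM : 0 < M) (hq : 1 ≤ q)
    (hint : ∀ c, Integrable (fun x => ‖Φ c x‖ ^ q) μ) {p : Ω → Prop} (hp : ∀ᵐ x ∂μ, p x)
    (hpM : ∀ x, p x → ∀ c, ‖Φ c x‖ ≤ M * ‖c‖) {η : ℝ} (hη : 0 < η) :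
    ∃ n₀ : ℕ, ∀ n ≥ n₀, ∃ z : Fin n → {x // p x}, ∀ c, ‖c‖ ≤ 1 →
      |∑ j, ‖Φ c (z j).1‖ ^ q - n * ∫ x, ‖Φ c x‖ ^ q ∂μ| ≤ n * η := by
  set u := TopologicalSpace.denseSeq (EuclideanSpace 𝕜 (Fin d)) with hu
  obtain ⟨ω, hω, hlim⟩ := exists_seq_tendsto_average μ (fun i x => ‖Φ (u i) x‖ ^ q)
    (fun i => hint _) hp
  set B := q * (2 * M) ^ (q - 1) * M with hB
  have hBpos : 0 < B := by
    have := Real.rpow_pos_of_pos (by positivity : 0 < 2 * M) (q - 1)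
    positivity
  set δ := min 1 (η / (3 * B)) with hδ
  have hδ0 : 0 < δ := lt_min one_pos (by positivity)
  have hδB : B * δ ≤ η / 3 := by
    calc B * δ ≤ B * (η / (3 * B)) := by gcongr; exact min_le_right _ _
      _ = η / 3 := by field_simp
  obtain ⟨t, ht⟩ := (isCompact_closedBall (0 : EuclideanSpace 𝕜 (Fin d)) 1).elim_finite_subcover
    (fun i => Metric.ball (u i) δ) (fun _ => Metric.isOpen_ball) (fun c _ => by
      obtain ⟨i, hi⟩ := (TopologicalSpace.denseRange_denseSeq _).exists_dist_lt c hδ0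
      exact Set.mem_iUnion.2 ⟨i, hi⟩)
  have hev : ∀ᶠ n : ℕ in atTop, ∀ i ∈ t,
      |(∑ k ∈ Finset.range n, ‖Φ (u i) (ω k)‖ ^ q) / n - ∫ x, ‖Φ (u i) x‖ ^ q ∂μ| < η / 3 := by
    rw [Filter.eventually_all_finset]
    intro i _
    exact Metric.tendsto_nhds.1 (hlim i) _ (by positivity)
  obtain ⟨n₀, hn₀⟩ := eventually_atTop.1 hev
  refine ⟨max n₀ 1, fun n hn => ⟨fun j => ⟨ω j, hω j⟩, fun c hc => ?_⟩⟩
  have hn0 : (0 : ℝ) < n := by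
    have : 0 < n := lt_of_lt_of_le one_pos ((le_max_right _ _).trans hn)
    exact_mod_cast this
  obtain ⟨i, hit, hi⟩ := Set.mem_iUnion₂.1 (ht (mem_closedBall_zero_iff.2 hc))
  rw [Metric.mem_ball, dist_eq_norm] at hi
  have hui : ‖u i‖ ≤ 2 := by
    have h1 : ‖u i‖ ≤ ‖c‖ + ‖c - u i‖ := by
      have := norm_sub_norm_le (u i) c
      rw [norm_sub_rev] at this
      linarith
    have h2 : δ ≤ 1 := min_le_left _ _
    linarith
  have hpt : ∀ x, p x → |‖Φ c x‖ ^ q - ‖Φ (u i) x‖ ^ q| ≤ η / 3 := by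
    intro x hx
    have e1 : ‖Φ c x‖ ≤ 2 * M := by nlinarith [hpM x hx c]
    have e2 : ‖Φ (u i) x‖ ≤ 2 * M := by nlinarith [hpM x hx (u i)]
    have e3 : |‖Φ c x‖ - ‖Φ (u i) x‖| ≤ M * δ := by
      refine (abs_norm_sub_norm_le _ _).trans ?_
      have h := hpM x hx (c - u i)
      rw [map_sub, Pi.sub_apply] at h
      refine h.trans ?_
      gcongr
    refine (abs_rpow_sub_rpow_le hq ⟨norm_nonneg _, e1⟩ ⟨norm_nonneg _, e2⟩).trans ?_
    have h2M := Real.rpow_nonneg (by positivity : 0 ≤ 2 * M) (q - 1)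
    calc q * (2 * M) ^ (q - 1) * |‖Φ c x‖ - ‖Φ (u i) x‖|
        ≤ q * (2 * M) ^ (q - 1) * (M * δ) := by gcongr
      _ = B * δ := by rw [hB]; ring
      _ ≤ _ := hδB
  have hQ : |∫ x, ‖Φ c x‖ ^ q ∂μ - ∫ x, ‖Φ (u i) x‖ ^ q ∂μ| ≤ η / 3 := by
    rw [← integral_sub (hint _) (hint _)]
    have := norm_integral_le_of_norm_le_const (μ := μ)
      (f := fun x => ‖Φ c x‖ ^ q - ‖Φ (u i) x‖ ^ q) (C := η / 3) (hp.mono fun x hx => hpt x hx)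
    simpa using this
  have hS : |∑ j : Fin n, ‖Φ c (ω j)‖ ^ q - ∑ j : Fin n, ‖Φ (u i) (ω j)‖ ^ q| ≤ n * (η / 3) := by
    rw [← Finset.sum_sub_distrib]
    refine (Finset.abs_sum_le_sum_abs _ _).trans ?_
    refine (Finset.sum_le_sum fun (j : Fin n) _ => hpt (ω j) (hω j)).trans ?_
    simp
  have hlast := hn₀ n ((le_max_left _ _).trans hn) i hit
  have hlast' : |∑ j : Fin n, ‖Φ (u i) (ω j)‖ ^ q - n * ∫ x, ‖Φ (u i) x‖ ^ q ∂μ| ≤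
      n * (η / 3) := by
    rw [Fin.sum_univ_eq_sum_range fun k => ‖Φ (u i) (ω k)‖ ^ q]
    have e : ∑ k ∈ Finset.range n, ‖Φ (u i) (ω k)‖ ^ q - n * ∫ x, ‖Φ (u i) x‖ ^ q ∂μ =
        n * ((∑ k ∈ Finset.range n, ‖Φ (u i) (ω k)‖ ^ q) / n - ∫ x, ‖Φ (u i) x‖ ^ q ∂μ) := by
      field_simp
    rw [e, abs_mul, abs_of_pos hn0]
    gcongr
  have hQ' : |n * ∫ x, ‖Φ c x‖ ^ q ∂μ - n * ∫ x, ‖Φ (u i) x‖ ^ q ∂μ| ≤ n * (η / 3) := by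
    rw [← mul_sub, abs_mul, abs_of_pos hn0]
    gcongr
  rw [abs_le] at hS hlast' hQ' ⊢
  constructor <;> linarith [hS.1, hS.2, hlast'.1, hlast'.2, hQ'.1, hQ'.2]

end Sampling

/-! ### Pointwise bounds and Euclidean coordinates for the function space. -/

section Parametrization

variable {Ω 𝕜 : Type*} [MeasurableSpace Ω] [RCLike 𝕜] {μ : Measure Ω}

/-- The linear map sending the elements of a space of functions to their classes in `L²`. -/
noncomputable def submoduleToL2 (X : Submodule 𝕜 (Ω → 𝕜)) (hX : ∀ f ∈ X, MemLp f 2 μ) :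
    X →ₗ[𝕜] Lp 𝕜 2 μ where
  toFun f := (hX f.1 f.2).toLp f.1
  map_add' f g := MemLp.toLp_add (hX f.1 f.2) (hX g.1 g.2)
  map_smul' c f := MemLp.toLp_const_smul c (hX f.1 f.2)

lemma norm_submoduleToL2 (X : Submodule 𝕜 (Ω → 𝕜)) (hX : ∀ f ∈ X, MemLp f 2 μ) (f : X) :
    ‖submoduleToL2 X hX f‖ = (eLpNorm f.1 2 μ).toReal :=
  Lp.norm_toLp f.1 (hX f.1 f.2)

/-- Under the Nikol'skii inequality almost every point evaluation is bounded on the whole space. -/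
lemma ae_forall_norm_le {N : ℕ} {t : ℝ} (ht : 0 ≤ t) {X : Submodule 𝕜 (Ω → 𝕜)}
    (hX : ∀ f ∈ X, MemLp f 2 μ) {u : Fin N → Ω → 𝕜}
    (hu : X = Submodule.span 𝕜 (Set.range u)) (hnik : NikolskiiTwoInfty μ N t X) :
    ∀ᵐ x ∂μ, ∀ f ∈ X, ‖f x‖ ≤ t * Real.sqrt N * (eLpNorm f 2 μ).toReal := by
  have huX : ∀ i, u i ∈ X := fun i => hu ▸ Submodule.subset_span ⟨i, rfl⟩
  set g : (Fin N → 𝕜) → X := fun c => ∑ i, c i • (⟨u i, huX i⟩ : X) with hg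
  have hgx : ∀ c x, (g c).1 x = ∑ i, c i * u i x := by
    intro c x
    simp [hg, Finset.sum_apply]
  have hone : ∀ f ∈ X, ∀ᵐ x ∂μ, ‖f x‖ ≤ t * Real.sqrt N * (eLpNorm f 2 μ).toReal := by
    intro f hf
    have h1 := hnik f hf
    have hfin : eLpNorm f 2 μ ≠ ⊤ := (hX f hf).2.ne
    rw [eLpNorm_exponent_top] at h1
    filter_upwards [enorm_ae_le_eLpNormEssSup f μ] with x hx
    have h2 := hx.trans h1
    rw [← ENNReal.ofReal_toReal hfin, ← ENNReal.ofReal_mul (by positivity),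
      ← ofReal_norm] at h2
    exact (ENNReal.ofReal_le_ofReal_iff (by positivity)).1 h2
  -- The null set in the Nikol'skii inequality depends on the function. Countably many coefficient
  -- vectors give one null set, and continuity in the coefficients extends the bound to the whole
  -- space.
  have hdense : ∀ᵐ x ∂μ, ∀ k : ℕ, ‖(g (TopologicalSpace.denseSeq _ k)).1 x‖ ≤
      t * Real.sqrt N * ‖submoduleToL2 X hX (g (TopologicalSpace.denseSeq _ k))‖ :=
    ae_all_iff.2 fun k => by
      rw [norm_submoduleToL2]
      exact hone _ (g _).2
  filter_upwards [hdense] with x hx f hf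
  obtain ⟨c, hc⟩ : ∃ c, f = (g c).1 := by
    rw [hu, Submodule.mem_span_range_iff_exists_fun] at hf
    obtain ⟨c, hc⟩ := hf
    refine ⟨c, ?_⟩
    rw [← hc, hg]
    simp
  have hall : ∀ c, ‖(g c).1 x‖ ≤ t * Real.sqrt N * ‖submoduleToL2 X hX (g c)‖ := by
    intro c
    refine (TopologicalSpace.denseRange_denseSeq (Fin N → 𝕜)).induction_on
      (p := fun c => ‖(g c).1 x‖ ≤ t * Real.sqrt N * ‖submoduleToL2 X hX (g c)‖) c ?_ hx
    have h1 : Continuous fun c => (g c).1 x := by simp only [hgx]; fun_prop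
    have h2 : Continuous fun c => submoduleToL2 X hX (g c) := by
      simp only [hg, map_sum, map_smul]; fun_prop
    exact isClosed_le h1.norm (h2.norm.const_mul _)
  rw [hc, ← norm_submoduleToL2 X hX]
  exact hall c

/-- An `L²`-isometric parametrization of a finite-dimensional space of functions, up to functions
vanishing almost everywhere. -/
lemma exists_isometric_parametrization {N : ℕ} {X : Submodule 𝕜 (Ω → 𝕜)}
    (hX : ∀ f ∈ X, MemLp f 2 μ) {u : Fin N → Ω → 𝕜}
    (hu : X = Submodule.span 𝕜 (Set.range u)) :
    ∃ (d : ℕ) (Φ : EuclideanSpace 𝕜 (Fin d) →ₗ[𝕜] (Ω → 𝕜)), d ≤ N ∧ (∀ c, Φ c ∈ X) ∧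
      (∀ c, (eLpNorm (Φ c) 2 μ).toReal = ‖c‖) ∧
      ∀ f ∈ X, ∃ c, (eLpNorm (f - Φ c) 2 μ).toReal = 0 := by
  have hfin : FiniteDimensional 𝕜 X := by
    rw [hu]; exact FiniteDimensional.span_of_finite 𝕜 (Set.finite_range u)
  set T := submoduleToL2 X hX with hT
  -- Coordinates live on the image in `L²`, since distinct elements of `X` may agree almost
  -- everywhere.
  set b := stdOrthonormalBasis 𝕜 (LinearMap.range T) with hb
  choose g hg using fun i => (b i).2
  set Ψ : EuclideanSpace 𝕜 (Fin (Module.finrank 𝕜 (LinearMap.range T))) →ₗ[𝕜] X :=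
    (Fintype.linearCombination 𝕜 g) ∘ₗ (WithLp.linearEquiv 2 𝕜 _).toLinearMap with hΨ
  have hTΨ : ∀ c, T (Ψ c) = (b.repr.symm c : LinearMap.range T) := by
    intro c
    have h1 : Ψ c = ∑ i, c i • g i := by
      simp [hΨ, Fintype.linearCombination_apply]
    have h2 : b.repr.symm c = ∑ i, c i • b i := by
      rw [← b.sum_repr (b.repr.symm c)]
      simp
    rw [h1, h2, map_sum, Submodule.coe_sum]
    refine Finset.sum_congr rfl fun i _ => ?_
    rw [map_smul, hg, Submodule.coe_smul]
  refine ⟨_, X.subtype ∘ₗ Ψ, ?_, fun c => (Ψ c).2, fun c => ?_, fun f hf => ?_⟩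
  · refine (LinearMap.finrank_range_le T).trans ?_
    have h1 := finrank_range_le_card (R := 𝕜) u
    rw [Fintype.card_fin, Set.finrank] at h1
    rwa [hu]
  · have h1 := norm_submoduleToL2 X hX (Ψ c)
    rw [← hT, hTΨ, ← Submodule.coe_norm, LinearIsometryEquiv.norm_map] at h1
    exact h1.symm
  · let f' : X := ⟨f, hf⟩
    let y : LinearMap.range T := ⟨T f', LinearMap.mem_range_self T f'⟩
    refine ⟨b.repr y, ?_⟩
    have h1 := norm_submoduleToL2 X hX (f' - Ψ (b.repr y))
    have h2 : T (f' - Ψ (b.repr y)) = 0 := by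
      rw [map_sub, hTΨ, LinearIsometryEquiv.symm_apply_apply]
      exact sub_self (T f')
    rw [← hT, h2, norm_zero] at h1
    exact h1.symm

end Parametrization

/-! ### Assembly. -/

theorem mainTheorem1 (t q ε : ℝ) (ht : 0 < t) (hq : 2 ≤ q) (hε : ε ∈ Set.Ioo (0 : ℝ) 1) :
    ∃ C : ℝ, 0 < C ∧
      ∀ (𝕜 : Type*) [RCLike 𝕜] (Ω : Type*) [MeasurableSpace Ω] (μ : Measure Ω)
        [IsProbabilityMeasure μ] (E : Set Ω) (N : ℕ) (X : Submodule 𝕜 (Ω → 𝕜)),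
        μ E = 0 → 2 ≤ N → IsLqSubspace μ q N X → NikolskiiTwoInfty μ N t X →
        ∀ m : ℕ, C * (N : ℝ) ^ (q / 2) * Real.log (N : ℝ) ^ (2 - 2 / q) ≤ (m : ℝ) →
          MarcinkiewiczDiscretizationEps μ E X m q ε := by
  obtain ⟨C, hC, hmain⟩ := exists_const_exists_points ht hq hε.1 hε.2.le
  refine ⟨C, hC, ?_⟩
  intro 𝕜 _ Ω _ μ _ E N X hE hN hX hnik m hm
  obtain ⟨⟨u, hu⟩, hXq⟩ := hX
  have hq0 : 0 < q := by linarith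
  have hN0 : (0 : ℝ) < N := by exact_mod_cast (by omega : 0 < N)
  have h2q : (2 : ENNReal) ≤ ENNReal.ofReal q := by
    rw [← ENNReal.ofReal_ofNat 2]; exact ENNReal.ofReal_le_ofReal hq
  have hqne : ENNReal.ofReal q ≠ 0 := (ENNReal.ofReal_pos.2 hq0).ne'
  have hqr : (ENNReal.ofReal q).toReal = q := ENNReal.toReal_ofReal hq0.le
  have hX2 : ∀ f ∈ X, MemLp f 2 μ := fun f hf => (hXq f hf).mono_exponent h2q
  have hnorm : ∀ f ∈ X, (eLpNorm f (ENNReal.ofReal q) μ).toReal =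
      (∫ x, ‖f x‖ ^ q ∂μ) ^ q⁻¹ := fun f hf => by
    rw [(hXq f hf).eLpNorm_eq_integral_rpow_norm hqne ENNReal.ofReal_ne_top, hqr,
      ENNReal.toReal_ofReal]
    exact Real.rpow_nonneg (integral_nonneg fun x => by positivity) _
  have hmono : ∀ f ∈ X, (eLpNorm f 2 μ).toReal ≤ (eLpNorm f (ENNReal.ofReal q) μ).toReal :=
    fun f hf => ENNReal.toReal_mono (hXq f hf).2.ne
      (eLpNorm_le_eLpNorm_of_exponent_le h2q (hXq f hf).1)
  obtain ⟨d, Φ, hdN, hΦX, hΦnorm, hΦsurj⟩ := exists_isometric_parametrization hX2 hu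
  -- The admissible points: outside `E`, with the evaluation bound for all of `X` at once. All
  -- sampling happens among them.
  set p : Ω → Prop := fun x =>
    x ∉ E ∧ ∀ f ∈ X, ‖f x‖ ≤ t * Real.sqrt N * (eLpNorm f 2 μ).toReal with hp
  have hpae : ∀ᵐ x ∂μ, p x :=
    (measure_eq_zero_iff_ae_notMem.1 hE).and (ae_forall_norm_le ht.le hX2 hu hnik)
  have hpM : ∀ x, p x → ∀ c, ‖Φ c x‖ ≤ t * Real.sqrt N * ‖c‖ := fun x hx c => by
    rw [← hΦnorm]; exact hx.2 _ (hΦX c)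
  have hM : 0 < t * Real.sqrt N := by positivity
  set Q : EuclideanSpace 𝕜 (Fin d) → ℝ := fun c => ∫ x, ‖Φ c x‖ ^ q ∂μ with hQ
  have hQ0 : ∀ c, 0 ≤ Q c := fun c => integral_nonneg fun x => by positivity
  have hQq : ∀ c, (Q c ^ q⁻¹) ^ q = Q c := fun c => Real.rpow_inv_rpow (hQ0 c) hq0.ne'
  have hQlow : ∀ c, ‖c‖ ^ q ≤ Q c := fun c => by
    rw [← hQq c]
    refine Real.rpow_le_rpow (norm_nonneg _) ?_ hq0.le
    rw [← hΦnorm, ← hnorm _ (hΦX c)]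
    exact hmono _ (hΦX c)
  have hQ2 : q = 2 → ∀ c, Q c = ‖c‖ ^ 2 := fun h c => by
    have h1 := hnorm _ (hΦX c)
    rw [h, ENNReal.ofReal_ofNat, hΦnorm, ← h] at h1
    rw [h1, ← Real.rpow_two, ← h, hQq c]
  have hint : ∀ c, Integrable (fun x => ‖Φ c x‖ ^ q) μ := fun c => by
    have := (hXq _ (hΦX c)).integrable_norm_rpow'
    rwa [hqr] at this
  obtain ⟨hm0, w, hw⟩ := hmain 𝕜 d N hdN hN {x // p x}
    (fun x => (LinearMap.proj x.1 : (Ω → 𝕜) →ₗ[𝕜] 𝕜) ∘ₗ Φ) Q (fun x c => hpM x.1 x.2 c)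
    hQlow hQ2 (fun η hη => exists_asymptotic_discretization μ Φ hM (by linarith) hint hpae hpM hη)
    m hm
  have hm' : (0 : ℝ) < m := Nat.cast_pos.2 hm0
  -- The absolute error on `Q c ≤ 1` becomes relative by homogeneity, rescaling `c` to `Q c = 1`.
  have hrel : ∀ c, |∑ j, ‖Φ c (w j).1‖ ^ q - m * Q c| ≤ m * ε * Q c := by
    intro c
    rcases (hQ0 c).eq_or_lt with h0 | hpos
    · have hc : c = 0 := by
        by_contra hne
        have := Real.rpow_pos_of_pos (norm_pos_iff.2 hne) q
        linarith [hQlow c]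
      rw [← h0, hc]
      simp [Real.zero_rpow hq0.ne']
    · set r := (Q c)⁻¹ ^ q⁻¹ with hr
      have hr0 : 0 ≤ r := Real.rpow_nonneg (by positivity) _
      have hrq : r ^ q = (Q c)⁻¹ := Real.rpow_inv_rpow (by positivity) hq0.ne'
      have hs : ∀ x, ‖Φ ((r : 𝕜) • c) x‖ ^ q = (Q c)⁻¹ * ‖Φ c x‖ ^ q := fun x => by
        rw [map_smul, Pi.smul_apply, norm_smul, RCLike.norm_ofReal, abs_of_nonneg hr0,
          Real.mul_rpow hr0 (norm_nonneg _), hrq]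
      have hQr : Q ((r : 𝕜) • c) = 1 := by
        simp only [hQ, hs, integral_const_mul]
        exact inv_mul_cancel₀ hpos.ne'
      have h1 := hw ((r : 𝕜) • c) hQr.le
      simp only [LinearMap.comp_apply, LinearMap.proj_apply, hs, hQr, ← Finset.mul_sum] at h1
      have h2 : (Q c)⁻¹ * ∑ j, ‖Φ c (w j).1‖ ^ q - m * 1 =
          (Q c)⁻¹ * (∑ j, ‖Φ c (w j).1‖ ^ q - m * Q c) := by field_simp
      rw [h2, abs_mul, abs_of_pos (inv_pos.2 hpos), inv_mul_le_iff₀ hpos] at h1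
      linarith
  refine ⟨fun j => (w j).1, fun j => (w j).2.1, fun f hf => ?_⟩
  obtain ⟨c, hc⟩ := hΦsurj f hf
  -- At an admissible point an element of `X` with zero `L²` norm vanishes exactly, so passing to `Φ
  -- c` changes no sampled value.
  have hfx : ∀ x, p x → f x = Φ c x := fun x hx => by
    have := hx.2 _ (X.sub_mem hf (hΦX c))
    rw [hc, mul_zero, Pi.sub_apply] at this
    exact sub_eq_zero.1 (norm_le_zero_iff.1 this)
  have hfQ : ∫ x, ‖f x‖ ^ q ∂μ = Q c :=
    integral_congr_ae (hpae.mono fun x hx => by simp only [hfx x hx])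
  have hsum : ∑ j, ‖f (w j).1‖ ^ q = ∑ j, ‖Φ c (w j).1‖ ^ q :=
    Finset.sum_congr rfl fun j _ => by rw [hfx _ (w j).2]
  rw [hfQ, hsum]
  have h := abs_le.1 (hrel c)
  have e : ∀ a : ℝ, a * Q c = 1 / m * (m * a * Q c) := fun a => by field_simp
  rw [e (1 - ε), e (1 + ε)]
  constructor <;> gcongr <;> linarith [h.1, h.2]
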